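/- Let $X=(X_t)_{t\ge 0}$ be a real-valued Lévy process and let $\zeta\in(0,\infty]$ be an exponential time of parameter $q\ge 0$ independent of $X$ ($\zeta=\infty$ a.s. if $q=0$). Let $\xi$ be $X$ killed at time $\zeta$, i.e. $\xi_t=X_t$ for $t<\zeta$ and $\xi_t=-\infty$ for $t\ge\zeta$, with the convention $e^{\lambda\cdot(-\infty)}=0$ for $\Re\lambda>0$. Assume that either $q>0$, or $q=0$ and $\lim_{t\to\infty}\xi_t=-\infty$ a.s. Let $$I=\int_0^{\zeta}e^{\xi_s}\,ds .$$ Then the characteristic exponent $\Psi$ of $\xi$, determined by $\mathbb E[e^{i\lambda\xi_t},\,t<\zeta]=e^{-t\Psi(\lambda)}$ for all $t\ge0$ and $\lambda\in\mathbb R$, extends to the strip $\{z\in\mathbb C:\ \mathbb E[|e^{iz\xi_1}|,\,1<\zeta]<\infty\}$, continuously on the strip and analytically in its interior; every such extension is denoted by $\Psi$ again. Let $$C=\{\beta\in\mathbb C:\ \Re\beta>0,\ \mathbb E[|e^{\beta\xi_1}|,\,1<\zeta]<\infty,\ |\mathbb E[e^{\beta\xi_1},\,1<\zeta]|<1\}.$$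 For every $\beta\in C$: 1. $\Psi(-i\beta)\neq0$; 2. $\mathbb E(I^{\Re\beta})<\infty$ if and only if $\mathbb E[e^{(\Re\beta)\xi_1},\,1<\zeta]<1$ (in particular $\mathbb E(I^{\beta})<\infty$ whenever $\beta\in C$ is real); 3. whenever the moment of order $\beta$ of $I$ exists, i.e. $\mathbb E(I^{\Re\beta})<\infty$, also $\mathbb E(I^{\Re\beta-1})<\infty$, the random variables $I^{\beta}$ and $I^{\beta-1}$ are integrable, and $$\mathbb E(I^{\beta})=\frac{\beta}{\Psi(-i\beta)}\,\mathbb E(I^{\beta-1}).$$ -/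

import Mathlib

open MeasureTheory ProbabilityTheory Filter Set Topology
open scoped NNReal ENNReal

namespace ExpFunctional

variable {Ω : Type*} [MeasurableSpace Ω]

/-- A function on `[0, ∞)` that is right-continuous with left limits. -/
def IsCadlag (f : ℝ≥0 → ℝ) : Prop :=
  ∀ t, ContinuousWithinAt f (Ici t) t ∧ ∃ l, Tendsto f (𝓝[<] t) (𝓝 l)

/-- A real valued Lévy process (with infinite lifetime) under `μ`: it starts from `0`, has
independent and stationary increments, and has almost surely càdlàg paths. -/
structure IsLevyProcess (X : ℝ≥0 → Ω → ℝ) (μ : Measure Ω) : Prop where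
  measurable : ∀ t, Measurable (X t)
  start_zero : ∀ᵐ ω ∂μ, X 0 ω = 0
  indep_increments : HasIndepIncrements X μ
  stationary_increments : ∀ s t, IdentDistrib (fun ω => X (s + t) ω - X s ω) (X t) μ μ
  cadlag : ∀ᵐ ω ∂μ, IsCadlag (fun t => X t ω)

/-- `ζ` is an exponential time of parameter `q ≥ 0` that is independent of the whole process `X`;
for `q = 0` this means that `ζ = ∞` almost surely. -/
structure IsIndepExpTime (X : ℝ≥0 → Ω → ℝ) (ζ : Ω → ℝ≥0∞) (q : ℝ) (μ : Measure Ω) : Prop where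
  rate_nonneg : 0 ≤ q
  measurable : Measurable ζ
  tail : ∀ t : ℝ≥0, μ {ω | (t : ℝ≥0∞) < ζ ω} = ENNReal.ofReal (Real.exp (-(q * t)))
  indep : IndepFun (fun ω t => X t ω) ζ μ

/-- The measure `μ(· , t < ζ)`. The killed process `ξ` equals `X` before the lifetime `ζ` and `-∞`
from `ζ` on, so that `E[f(ξ_t), t < ζ]` is the integral of `f (X t)` with respect to this measure;
with `e^{λ · (-∞)} = 0` for `Re λ > 0`, this measure also computes `E[e^{λ ξ_t}]`. -/
noncomputable def aliveMeasure (ζ : Ω → ℝ≥0∞) (μ : Measure Ω) (t : ℝ≥0) : Measure Ω :=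
  μ.restrict {ω | (t : ℝ≥0∞) < ζ ω}

/-- The set of real `a` such that `E[e^{a ξ₁}, 1 < ζ] < ∞`. -/
def expMomentSet (X : ℝ≥0 → Ω → ℝ) (ζ : Ω → ℝ≥0∞) (μ : Measure Ω) : Set ℝ :=
  integrableExpSet (X 1) (aliveMeasure ζ μ 1)

/-- `Ψ` is the characteristic exponent of the killed process, together with its analytic
extension: `E[e^{iλ ξ_t}, t < ζ] = e^{-t Ψ(λ)}` for real `λ` and all `t ≥ 0`, and `Ψ` is
continuous on the strip of all `z` with `E[|e^{i z ξ₁}|, 1 < ζ] < ∞` and complex differentiable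
on the interior of this strip. Here `|e^{i z x}| = e^{-x Im z}` for real `x`. -/
structure IsCharExponent (X : ℝ≥0 → Ω → ℝ) (ζ : Ω → ℝ≥0∞) (μ : Measure Ω) (Ψ : ℂ → ℂ) :
    Prop where
  charFun_eq : ∀ (l : ℝ) (t : ℝ≥0),
    ∫ ω, Complex.exp (Complex.I * l * X t ω) ∂(aliveMeasure ζ μ t) = Complex.exp (-(t * Ψ l))
  continuousOn : ContinuousOn Ψ {z | -z.im ∈ expMomentSet X ζ μ}
  differentiableOn : DifferentiableOn ℂ Ψ {z | -z.im ∈ interior (expMomentSet X ζ μ)}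

/-- The set of complex `β` with `Re β > 0` such that `E[e^{β ξ₁}, 1 < ζ]` converges absolutely and
has modulus less than `1`. -/
def admissible (X : ℝ≥0 → Ω → ℝ) (ζ : Ω → ℝ≥0∞) (μ : Measure Ω) : Set ℂ :=
  {β | 0 < β.re ∧ β.re ∈ expMomentSet X ζ μ ∧ ‖complexMGF (X 1) (aliveMeasure ζ μ 1) β‖ < 1}

/-- The exponential functional `I = ∫₀^ζ e^{ξ_s} ds`, with values in `[0, ∞]`. -/
noncomputable def expFunctional (X : ℝ≥0 → Ω → ℝ) (ζ : Ω → ℝ≥0∞) (ω : Ω) : ℝ≥0∞ :=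
  ∫⁻ s in {s : ℝ | 0 ≤ s ∧ ENNReal.ofReal s < ζ ω}, ENNReal.ofReal (Real.exp (X s.toNNReal ω))

/-- The absolute moment `E(I^a) ∈ [0, ∞]` of real order `a`. -/
noncomputable def absMoment (X : ℝ≥0 → Ω → ℝ) (ζ : Ω → ℝ≥0∞) (μ : Measure Ω) (a : ℝ) : ℝ≥0∞ :=
  ∫⁻ ω, expFunctional X ζ ω ^ a ∂μ

/-- The random variable `I^β` for complex `β`. -/
noncomputable def expFunctionalCpow (X : ℝ≥0 → Ω → ℝ) (ζ : Ω → ℝ≥0∞) (β : ℂ) (ω : Ω) : ℂ :=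
  ((expFunctional X ζ ω).toReal : ℂ) ^ β

end ExpFunctional

/-! Fix a path and let T_s be the integral of e^ξ over [s, ζ). Splitting off the value at s gives
T_s = e^{ξ_s} I'_s, where I'_s is the exponential functional of the restarted path with the residual
lifetime. Formally -d(T_s^β) = β e^{ξ_s} T_s^{β-1} ds = β e^{βξ_s} (I'_s)^{β-1} ds, hence I^β = β
∫_0^ζ e^{βξ_s} (I'_s)^{β-1} ds. By the Markov property, on {s < ζ} the variable I'_s is independent
of ξ_s and has the law of I. So the expectation of the right side is β E(I^{β-1}) ∫_0^∞ e^{-sΨ(-iβ)}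
ds, and |E e^{βξ_1}| < 1 says exactly that Re Ψ(-iβ) > 0, so the last integral is 1/Ψ(-iβ). The
pathwise identity is obtained from the probability integral transform (`map_tail_eq`) for the
measure e^{x_s} ds, the Markov property is `IsIndepExpTime.map_restart`, and
`IsRegularLevy.integral_cpow_eq` combines them. Fubini is justified by the same identity for the
real order Re β, in [0, ∞] (`IsRegularLevy.absMoment_eq`), which also yields finiteness of the
moment of order Re β - 1.

For the finiteness criterion write b = Re β and m = E[e^{bξ_1}, 1 < ζ]. On {1 < ζ}, I = ∫_0^1
e^{ξ_s} ds + e^{ξ_1} I'_1 with a positive first term, so a finite moment satisfies m E(I^b) <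
E(I^b), that is m < 1. Conversely I is at most a sum over k of e^{ξ_k} times an integral over a unit
interval; the k-th term has b-th moment at most m^k D, and a geometric weighting sums these for
every b > 0. That D is finite needs E sup_{t<1} e^{bX_t} < ∞, which follows from E e^{bX_1} < ∞ by
Ottaviani's inequality (`IsRegularLevy.lintegral_gridMax_lt_top`).

The same supremum bound dominates the moment generating functions on the strip. They are
multiplicative and right-continuous in time, hence of the form e^{tκ(w)}, with κ continuous on the
strip and holomorphic inside; Ψ(z) = q - κ(iz) is an extension. Any other extension agrees with it
for Re β > 0. The real line may lie on the boundary of the strip, so the identity theorem alone is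
not enough; `eq_zero_of_strip` supplies uniqueness from boundary values. -/

namespace ExpFunctional

/-! ### Exponential integrals of right-continuous paths -/

/-- The path `u ↦ x (s + u) - x s`. -/
def shift (x : ℝ≥0 → ℝ) (s : ℝ≥0) : ℝ≥0 → ℝ := fun u => x (s + u) - x s

/-- Right-continuity of a path. -/
def IsRightCont (x : ℝ≥0 → ℝ) : Prop := ∀ t, ContinuousWithinAt x (Ici t) t

/-- The smallest multiple of `1 / (n + 1)` larger than `t`. -/
noncomputable def gridNext (n : ℕ) (t : ℝ≥0) : ℝ≥0 := (⌊(n + 1) * t⌋₊ + 1) / (n + 1)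

lemma lt_gridNext (n : ℕ) (t : ℝ≥0) : t < gridNext n t := by
  unfold gridNext
  rw [lt_div_iff₀ (by positivity), mul_comm]
  exact Nat.lt_floor_add_one _

lemma gridNext_le (n : ℕ) (t : ℝ≥0) : gridNext n t ≤ t + 1 / (n + 1) := by
  unfold gridNext
  rw [div_le_iff₀ (by positivity), add_mul t, one_div, inv_mul_cancel₀ (by positivity), mul_comm t]
  gcongr
  exact Nat.floor_le (by positivity)

lemma tendsto_gridNext (t : ℝ≥0) : Tendsto (fun n => gridNext n t) atTop (𝓝[≥] t) := by
  refine tendsto_nhdsWithin_iff.2 ⟨?_, Eventually.of_forall fun n => (lt_gridNext n t).le⟩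
  refine tendsto_of_tendsto_of_tendsto_of_le_of_le tendsto_const_nhds ?_
    (fun n => (lt_gridNext n t).le) (fun n => gridNext_le n t)
  have : Tendsto (fun n : ℕ => t + 1 / ((n : ℝ≥0) + 1)) atTop (𝓝 (t + 0)) :=
    tendsto_const_nhds.add tendsto_one_div_add_atTop_nhds_zero_nat
  simpa using this

lemma IsRightCont.tendsto_gridNext {x : ℝ≥0 → ℝ} (hx : IsRightCont x) (t : ℝ≥0) :
    Tendsto (fun n => x (gridNext n t)) atTop (𝓝 (x t)) :=
  (hx t).tendsto.comp (ExpFunctional.tendsto_gridNext t)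

lemma IsRightCont.shifted {x : ℝ≥0 → ℝ} (hx : IsRightCont x) (s : ℝ≥0) :
    IsRightCont (shift x s) := by
  intro t
  refine ContinuousWithinAt.sub ?_ continuousWithinAt_const
  exact (hx (s + t)).comp (by fun_prop) (fun u (hu : t ≤ u) => by
    simpa using hu)

/-- The rounded time depends on `t` only through a natural number, so joint measurability reduces to
countably many fixed times. No path regularity enters here; it is needed only to pass to the limit
in `n`. -/
lemma measurable_gridNext_eval {α : Type*} [MeasurableSpace α] (n : ℕ) {Y : ℝ≥0 → α → ℝ}
    (hY : ∀ t, Measurable (Y t)) : Measurable fun p : ℝ≥0 × α => Y (gridNext n p.1) p.2 := by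
  let Z : ℕ → α → ℝ := fun k => Y ((k + 1) / (n + 1))
  have h1 : Measurable fun p : ℕ × α => Z p.1 p.2 :=
    measurable_from_prod_countable_right fun k => (show Measurable (Z k) from hY _)
  have h2 : Measurable fun p : ℝ≥0 × α => ((⌊((n : ℝ≥0) + 1) * p.1⌋₊, p.2) : ℕ × α) := by
    refine Measurable.prodMk ?_ measurable_snd
    exact Nat.measurable_floor.comp (by fun_prop)
  have h3 := h1.comp h2
  simpa only [Function.comp_def, Z, gridNext] using h3

lemma measurable_uncurry_of_isRightCont {α : Type*} [MeasurableSpace α] {Y : ℝ≥0 → α → ℝ}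
    (hY : ∀ t, Measurable (Y t)) (hc : ∀ ω, IsRightCont fun t => Y t ω) :
    Measurable fun p : ℝ≥0 × α => Y p.1 p.2 :=
  measurable_of_tendsto_metrizable (fun n => measurable_gridNext_eval n hY)
    (tendsto_pi_nhds.2 fun p => (hc p.2).tendsto_gridNext p.1)

lemma IsRightCont.measurable {x : ℝ≥0 → ℝ} (hx : IsRightCont x) : Measurable x := by
  have := measurable_uncurry_of_isRightCont (α := Unit) (Y := fun t _ => x t)
    (fun t => measurable_const) (fun _ => hx)
  exact this.comp (f := fun t => (t, ())) (measurable_id.prodMk measurable_const)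

/-- The integral `∫₀ᶻ e^{x_s} ds`. -/
noncomputable def expInt (x : ℝ≥0 → ℝ) (z : ℝ≥0∞) : ℝ≥0∞ :=
  ∫⁻ s in {s : ℝ | 0 ≤ s ∧ ENNReal.ofReal s < z}, ENNReal.ofReal (Real.exp (x s.toNNReal))

/-- A version of `expInt` that is measurable for the product σ-algebra on paths and that agrees
with it on right-continuous paths. -/
noncomputable def expIntM (p : (ℝ≥0 → ℝ) × ℝ≥0∞) : ℝ≥0∞ :=
  ∫⁻ s : ℝ, {q : ℝ × ℝ≥0∞ | 0 ≤ q.1 ∧ ENNReal.ofReal q.1 < q.2}.indicator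
    (fun _ => liminf (fun n => ENNReal.ofReal (Real.exp (p.1 (gridNext n s.toNNReal)))) atTop)
    (s, p.2)

lemma measurableSet_alive_region :
    MeasurableSet {q : ℝ × ℝ≥0∞ | 0 ≤ q.1 ∧ ENNReal.ofReal q.1 < q.2} := by
  refine MeasurableSet.inter (measurableSet_le measurable_const measurable_fst) ?_
  exact measurableSet_lt (ENNReal.measurable_ofReal.comp measurable_fst) measurable_snd

lemma measurableSet_alive_section (z : ℝ≥0∞) :
    MeasurableSet {s : ℝ | 0 ≤ s ∧ ENNReal.ofReal s < z} :=
  (measurableSet_le measurable_const measurable_id).inter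
    (measurableSet_lt ENNReal.measurable_ofReal measurable_const)

/-- Laws of paths live on the product σ-algebra, and transferring expectations between such laws
requires a functional measurable on all paths, not only on right-continuous ones. The `liminf` along
the grids provides one. -/
lemma measurable_expIntM : Measurable expIntM := by
  have h : Measurable fun p : ((ℝ≥0 → ℝ) × ℝ≥0∞) × ℝ =>
      {q : ℝ × ℝ≥0∞ | 0 ≤ q.1 ∧ ENNReal.ofReal q.1 < q.2}.indicator
      (fun _ => liminf (fun n => ENNReal.ofReal (Real.exp (p.1.1 (gridNext n p.2.toNNReal)))) atTop)
      (p.2, p.1.2) := by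
    have h1 : Measurable fun p : ((ℝ≥0 → ℝ) × ℝ≥0∞) × ℝ =>
        liminf (fun n => ENNReal.ofReal (Real.exp (p.1.1 (gridNext n p.2.toNNReal)))) atTop := by
      refine Measurable.liminf fun n => ?_
      refine (Real.measurable_exp.comp ?_).ennreal_ofReal
      have := measurable_gridNext_eval (α := ℝ≥0 → ℝ) n (Y := fun t x => x t)
        (fun t => measurable_pi_apply t)
      exact this.comp (f := fun p : ((ℝ≥0 → ℝ) × ℝ≥0∞) × ℝ => (p.2.toNNReal, p.1.1)) (by fun_prop)
    have h2 : MeasurableSet {p : ((ℝ≥0 → ℝ) × ℝ≥0∞) × ℝ |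
        (p.2, p.1.2) ∈ {q : ℝ × ℝ≥0∞ | 0 ≤ q.1 ∧ ENNReal.ofReal q.1 < q.2}} :=
      measurableSet_alive_region.preimage
        (f := fun p : ((ℝ≥0 → ℝ) × ℝ≥0∞) × ℝ => (p.2, p.1.2)) (by fun_prop)
    exact h1.indicator h2
  exact h.lintegral_prod_right'

lemma IsRightCont.expIntM_eq {x : ℝ≥0 → ℝ} (hx : IsRightCont x) (z : ℝ≥0∞) :
    expIntM (x, z) = expInt x z := by
  unfold expIntM expInt
  rw [← lintegral_indicator (measurableSet_alive_section z)]
  refine lintegral_congr fun s => ?_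
  have : liminf (fun n => ENNReal.ofReal (Real.exp (x (gridNext n s.toNNReal)))) atTop
      = ENNReal.ofReal (Real.exp (x s.toNNReal)) :=
    Tendsto.liminf_eq (ENNReal.tendsto_ofReal
      ((Real.continuous_exp.tendsto _).comp (hx.tendsto_gridNext _)))
  by_cases hs : 0 ≤ s ∧ ENNReal.ofReal s < z
  · rw [indicator_of_mem (by exact hs), indicator_of_mem (by exact hs)]
    simpa using this
  · rw [indicator_of_notMem (by exact hs), indicator_of_notMem (by exact hs)]

/-- Splitting off the part of the integral after time `s`. -/
lemma lintegral_tail_eq (x : ℝ≥0 → ℝ) (z : ℝ≥0∞) (s : ℝ≥0) :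
    ∫⁻ r in {r : ℝ | s ≤ r ∧ ENNReal.ofReal r < z}, ENNReal.ofReal (Real.exp (x r.toNNReal)) =
      ENNReal.ofReal (Real.exp (x s)) * expInt (shift x s) (z - s) := by
  unfold expInt
  rw [← lintegral_const_mul' _ _ ENNReal.ofReal_ne_top,
    ← lintegral_indicator (measurableSet_alive_section _), ← lintegral_indicator]
  · rw [← lintegral_add_left_eq_self _ (s : ℝ)]
    refine lintegral_congr fun r => ?_
    have hiff : ((s : ℝ) ≤ s + r ∧ ENNReal.ofReal (s + r) < z) ↔
        (0 ≤ r ∧ ENNReal.ofReal r < z - s) := by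
      rw [le_add_iff_nonneg_right]
      refine and_congr_right fun hr => ?_
      rw [ENNReal.ofReal_add s.coe_nonneg hr, lt_tsub_iff_left, ENNReal.ofReal_coe_nnreal]
    by_cases hr : 0 ≤ r ∧ ENNReal.ofReal r < z - s
    · rw [indicator_of_mem (by exact hiff.2 hr), indicator_of_mem (by exact hr),
        ← ENNReal.ofReal_mul (Real.exp_pos _).le, ← Real.exp_add, shift,
        Real.toNNReal_add s.coe_nonneg hr.1, Real.toNNReal_coe]
      congr 2
      ring
    · rw [indicator_of_notMem (by exact fun h => hr (hiff.1 h)),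
        indicator_of_notMem (by exact hr)]
  · exact (measurableSet_le measurable_const measurable_id).inter
      (measurableSet_lt ENNReal.measurable_ofReal measurable_const)

/-- The self-similarity of the functional: after time `s` it is a scaled copy of itself for the
restarted path. -/
lemma expInt_eq_add (x : ℝ≥0 → ℝ) {z : ℝ≥0∞} {s : ℝ≥0} (h : (s : ℝ≥0∞) ≤ z) :
    expInt x z = expInt x s + ENNReal.ofReal (Real.exp (x s)) * expInt (shift x s) (z - s) := by
  rw [← lintegral_tail_eq, expInt, expInt, ← lintegral_union]
  · congr 2
    ext r
    simp only [mem_ofPred_eq, mem_union, ← ENNReal.ofReal_coe_nnreal (p := s)]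
    constructor
    · rintro ⟨h0, h1⟩
      rcases lt_or_ge r (s : ℝ) with hr | hr
      · exact Or.inl ⟨h0, (ENNReal.ofReal_lt_ofReal_iff_of_nonneg h0).2 hr⟩
      · exact Or.inr ⟨hr, h1⟩
    · rintro (⟨h0, h1⟩ | ⟨h0, h1⟩)
      · exact ⟨h0, h1.trans_le (by simpa using h)⟩
      · exact ⟨s.coe_nonneg.trans h0, h1⟩
  · exact (measurableSet_le measurable_const measurable_id).inter
      (measurableSet_lt ENNReal.measurable_ofReal measurable_const)
  · rw [Set.disjoint_left]
    rintro r ⟨h0, h1⟩ ⟨h2, -⟩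
    rw [← ENNReal.ofReal_coe_nnreal, ENNReal.ofReal_lt_ofReal_iff_of_nonneg h0] at h1
    exact absurd h1 (not_lt.2 h2)

lemma IsRightCont.measurable_exp {x : ℝ≥0 → ℝ} (hx : IsRightCont x) :
    Measurable fun s : ℝ => ENNReal.ofReal (Real.exp (x s.toNNReal)) := by
  have := hx.measurable
  fun_prop

lemma IsRightCont.expInt_pos {x : ℝ≥0 → ℝ} (hx : IsRightCont x) {z : ℝ≥0∞} (hz : 0 < z) :
    0 < expInt x z := by
  unfold expInt
  rw [lintegral_pos_iff_support hx.measurable_exp]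
  have : Function.support (fun s : ℝ => ENNReal.ofReal (Real.exp (x s.toNNReal))) = univ := by
    ext s
    simp [Real.exp_pos]
  rw [this, Measure.restrict_apply MeasurableSet.univ, univ_inter]
  obtain ⟨r, hr0, hr⟩ := ENNReal.lt_iff_exists_nnreal_btwn.1 hz
  have hr0' : 0 < r := by exact_mod_cast hr0
  calc (0 : ℝ≥0∞) < volume (Ioo (0 : ℝ) r) := by simpa using hr0'
    _ ≤ _ := by
      refine measure_mono fun s hs => ?_
      refine ⟨hs.1.le, lt_trans ?_ hr⟩
      rw [← ENNReal.ofReal_coe_nnreal, ENNReal.ofReal_lt_ofReal_iff_of_nonneg hs.1.le]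
      exact hs.2

end ExpFunctional

/-! ### The Markov property of the killed process -/

namespace ExpFunctional

/-- Path values at finitely many times become partial sums of increments along one monotone sequence
starting at 0. The sequence is constant after the largest point. -/
lemma exists_monotone_enumeration (I : Finset ℝ≥0) :
    ∃ u : ℕ → ℝ≥0, Monotone u ∧ u 0 = 0 ∧ ∀ i ∈ I, ∃ k, u k = i := by
  set J := insert 0 I with hJ
  have hpos : 0 < J.card := Finset.card_pos.2 ⟨0, by simp [hJ]⟩
  refine ⟨fun n => J.orderEmbOfFin rfl ⟨min n (J.card - 1), by omega⟩, ?_, ?_, ?_⟩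
  · intro a b hab
    refine (J.orderEmbOfFin rfl).monotone ?_
    simp only [Fin.mk_le_mk]
    omega
  · simp only [zero_le, inf_of_le_left]
    rw [Finset.orderEmbOfFin_zero rfl hpos]
    refine le_antisymm (Finset.min'_le _ _ (Finset.mem_insert_self _ _)) zero_le
  · intro i hi
    have : i ∈ Set.range (J.orderEmbOfFin rfl) := by
      rw [Finset.range_orderEmbOfFin]
      simp [hJ, hi]
    obtain ⟨k, hk⟩ := this
    refine ⟨k, ?_⟩
    rw [← hk]
    have hk2 : (k : ℕ) < J.card := k.2
    exact congrArg _ (Fin.ext (min_eq_left (Nat.le_sub_one_of_lt hk2)))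

variable {Ω : Type*} [MeasurableSpace Ω] {μ : Measure Ω} {X : ℝ≥0 → Ω → ℝ}

lemma IsLevyProcess.isProbabilityMeasure (hX : IsLevyProcess X μ) : IsProbabilityMeasure μ :=
  (hX.indep_increments 0 (fun _ => 0) (fun _ _ _ => le_rfl)).isProbabilityMeasure

lemma IsLevyProcess.map_increment (hX : IsLevyProcess X μ) {s t : ℝ≥0} (h : s ≤ t) :
    μ.map (fun ω => X t ω - X s ω) = μ.map (X (t - s)) := by
  have := (hX.stationary_increments s (t - s)).map_eq
  rwa [add_tsub_cancel_of_le h] at this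

lemma IsLevyProcess.measurable_shift (hX : IsLevyProcess X μ) (s : ℝ≥0) :
    Measurable fun ω => shift (fun t => X t ω) s :=
  measurable_pi_lambda _ fun u => (hX.measurable (s + u)).sub (hX.measurable s)

/-- The increments of the process after time `s` along a sequence of times have the same joint
law as those from time `0`. -/
lemma IsLevyProcess.map_increments_seq (hX : IsLevyProcess X μ) {u : ℕ → ℝ≥0} (hu : Monotone u)
    (s : ℝ≥0) :
    μ.map (fun ω j => X (s + u (j + 1)) ω - X (s + u j) ω) =
      μ.map (fun ω j => X (u (j + 1)) ω - X (u j) ω) := by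
  -- The joint law of the increments is a product whose factors depend only on the lengths of the
  -- steps, and a time shift does not change these lengths.
  have key : ∀ v : ℕ → ℝ≥0, Monotone v → μ.map (fun ω j => X (v (j + 1)) ω - X (v j) ω) =
      Measure.infinitePi (fun j => μ.map (X (v (j + 1) - v j))) := by
    intro v hv
    refine ((hX.indep_increments.nat hv).map_fun_eq_infinitePi_map
      fun j => (hX.measurable _).sub (hX.measurable _)).trans ?_
    congr 1
    ext1 j
    exact hX.map_increment (hv (Nat.le_succ j))
  rw [key _ hu, key (fun j => s + u j) fun a b h => add_le_add le_rfl (hu h)]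
  simp only [add_tsub_add_eq_tsub_left]

/-- Stationarity: the process restarted at time `s` has the law of the process itself. -/
lemma IsLevyProcess.map_shift (hX : IsLevyProcess X μ) (h0 : ∀ ω, X 0 ω = 0) (s : ℝ≥0) :
    μ.map (fun ω => shift (fun t => X t ω) s) = μ.map (fun ω t => X t ω) := by
  have := hX.isProbabilityMeasure
  refine (map_eq_iff_forall_finset_map_restrict_eq (X := fun u ω => shift (fun t => X t ω) s u)
    (Y := X) (hX.measurable_shift s).aemeasurable
    (measurable_pi_lambda _ hX.measurable).aemeasurable).2 fun I => ?_
  obtain ⟨u, hu, hu0, huI⟩ := exists_monotone_enumeration I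
  choose! k hk using huI
  let G : (ℕ → ℝ) → (I → ℝ) := fun d i => ∑ j ∈ Finset.range (k i), d j
  have hG : Measurable G := by
    refine measurable_pi_lambda _ fun i => ?_
    fun_prop
  have e1 : (fun ω => I.restrict fun t => shift (fun t => X t ω) s t) =
      G ∘ fun ω j => X (s + u (j + 1)) ω - X (s + u j) ω := by
    ext ω i
    simp only [Finset.restrict, shift, Function.comp, G]
    rw [Finset.sum_range_sub fun j => X (s + u j) ω, hu0, hk i i.2, add_zero]
  have e2 : (fun ω => I.restrict fun t => X t ω) =
      G ∘ fun ω j => X (u (j + 1)) ω - X (u j) ω := by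
    ext ω i
    simp only [Finset.restrict, Function.comp, G]
    rw [Finset.sum_range_sub fun j => X (u j) ω, hu0, hk i i.2, h0, sub_zero]
  rw [e1, e2, ← Measure.map_map hG, ← Measure.map_map hG, hX.map_increments_seq hu s]
  · exact measurable_pi_lambda _ fun j => (hX.measurable _).sub (hX.measurable _)
  · exact measurable_pi_lambda _ fun j => (hX.measurable _).sub (hX.measurable _)

/-- The Markov property at time `s`. -/
lemma IsLevyProcess.indepFun_shift (hX : IsLevyProcess X μ) (h0 : ∀ ω, X 0 ω = 0) (s : ℝ≥0) :
    IndepFun (X s) (fun ω => shift (fun t => X t ω) s) μ := by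
  have := hX.isProbabilityMeasure
  refine IndepFun.indepFun_process (Y := fun u ω => shift (fun t => X t ω) s u) (hX.measurable s)
    (fun u => (hX.measurable (s + u)).sub (hX.measurable s)) fun I => ?_
  obtain ⟨u, hu, hu0, huI⟩ := exists_monotone_enumeration I
  choose! k hk using huI
  -- Prepending time 0 makes increment number 0 equal to `X s`; all later increments belong to the
  -- restarted path.
  let v : ℕ → ℝ≥0 := fun n => n.casesOn 0 fun m => s + u m
  have hv : Monotone v := by
    refine monotone_nat_of_le_succ fun n => ?_
    cases n with
    | zero => exact zero_le
    | succ n => exact add_le_add le_rfl (hu (Nat.le_succ n))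
  have hind := hX.indep_increments.nat hv
  have hm : ∀ i, Measurable fun ω => X (v (i + 1)) ω - X (v i) ω :=
    fun i => (hX.measurable _).sub (hX.measurable _)
  let K := Finset.image (fun j => j + 1) (Finset.range (I.sup k))
  have h1 := hind.indepFun_finset {0} K (by simp [K]) hm
  let F : (({0} : Finset ℕ) → ℝ) → ℝ := fun d => d ⟨0, by simp⟩
  let G : (K → ℝ) → (I → ℝ) := fun d i => ∑ j ∈ (Finset.range (k i)).attach,
    d ⟨j + 1, by
      refine Finset.mem_image_of_mem _ (Finset.mem_range.2 ?_)
      exact (Finset.mem_range.1 j.2).trans_le (Finset.le_sup i.2)⟩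
  have hG : Measurable G := by
    refine measurable_pi_lambda _ fun i => ?_
    fun_prop
  have h2 := h1.comp (φ := F) (ψ := G) (by fun_prop) hG
  convert! h2 using 1
  · ext ω
    simp [F, v, hu0, h0]
  · ext ω i
    simp only [shift, Function.comp, G]
    rw [Finset.sum_attach (Finset.range (k i))
      (fun j => X (v (j + 1 + 1)) ω - X (v (j + 1)) ω), Finset.sum_range_sub fun j => X (v (j + 1)) ω]
    simp [v, hu0, hk i i.2]

variable {ζ : Ω → ℝ≥0∞} {q : ℝ}

lemma measurableSet_alive (hζ : IsIndepExpTime X ζ q μ) (s : ℝ≥0) :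
    MeasurableSet {ω | (s : ℝ≥0∞) < ζ ω} :=
  measurableSet_lt measurable_const hζ.measurable

/-- The exponential law has no memory. -/
lemma IsIndepExpTime.map_sub (hζ : IsIndepExpTime X ζ q μ) [IsProbabilityMeasure μ] (s : ℝ≥0) :
    ((μ.map ζ).restrict (Ioi (s : ℝ≥0∞))).map (fun z : ℝ≥0∞ => z - s) =
      ENNReal.ofReal (Real.exp (-(q * s))) • μ.map ζ := by
  have := Measure.isProbabilityMeasure_map (μ := μ) hζ.measurable.aemeasurable
  have hsub : Measurable fun z : ℝ≥0∞ => z - s := by fun_prop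
  have htail : ∀ t : ℝ≥0, μ.map ζ (Ioi (t : ℝ≥0∞)) = ENNReal.ofReal (Real.exp (-(q * t))) := by
    intro t
    rw [Measure.map_apply hζ.measurable measurableSet_Ioi]
    exact hζ.tail t
  have huniv : ((μ.map ζ).restrict (Ioi (s : ℝ≥0∞))).map (fun z : ℝ≥0∞ => z - s) univ =
      (ENNReal.ofReal (Real.exp (-(q * s))) • μ.map ζ) univ := by
    rw [Measure.map_apply hsub MeasurableSet.univ]
    simp [htail]
  have hfin : IsFiniteMeasure (ENNReal.ofReal (Real.exp (-(q * s))) • μ.map ζ) :=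
    Measure.smul_finite _ ENNReal.ofReal_ne_top
  refine Measure.ext_of_Iic _ _ fun a => ?_
  have hIoi : ((μ.map ζ).restrict (Ioi (s : ℝ≥0∞))).map (fun z : ℝ≥0∞ => z - s) (Ioi a) =
      (ENNReal.ofReal (Real.exp (-(q * s))) • μ.map ζ) (Ioi a) := by
    -- Both measures have the same total mass, so comparing the open upper half-lines suffices; the
    -- half-line above infinity is empty.
    induction a with
    | top => simp
    | coe t =>
      rw [Measure.map_apply hsub measurableSet_Ioi,
        Measure.restrict_apply (hsub measurableSet_Ioi)]
      have : (fun z : ℝ≥0∞ => z - s) ⁻¹' Ioi (t : ℝ≥0∞) ∩ Ioi (s : ℝ≥0∞) =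
          Ioi (((s + t : ℝ≥0)) : ℝ≥0∞) := by
        ext z
        simp only [mem_inter_iff, mem_preimage, mem_Ioi, lt_tsub_iff_left, ENNReal.coe_add]
        exact ⟨fun h => h.1, fun h => ⟨h, lt_of_le_of_lt le_self_add h⟩⟩
      rw [this, htail, Measure.smul_apply, htail, smul_eq_mul,
        ← ENNReal.ofReal_mul (Real.exp_pos _).le, ← Real.exp_add]
      congr 2
      push_cast
      ring
  rw [← compl_Ioi, measure_compl measurableSet_Ioi (measure_ne_top _ _),
    measure_compl measurableSet_Ioi (measure_ne_top _ _), huniv, hIoi]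

/-- Survival up to `s` concerns only `ζ`, so it leaves the law of any path functional unchanged and,
by lack of memory, leaves an independent residual lifetime with the original law. The factor is the
survival probability. -/
lemma IsIndepExpTime.map_alive (hX : IsLevyProcess X μ) (hζ : IsIndepExpTime X ζ q μ)
    {β : Type*} [MeasurableSpace β] {g : (ℝ≥0 → ℝ) → β} (hg : Measurable g) (s : ℝ≥0) :
    (aliveMeasure ζ μ s).map (fun ω => (g (fun t => X t ω), ζ ω - s)) =
      ENNReal.ofReal (Real.exp (-(q * s))) •
        ((μ.map (fun ω => g (fun t => X t ω))).prod (μ.map ζ)) := by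
  have := hX.isProbabilityMeasure
  have hgm : Measurable fun ω => g (fun t => X t ω) :=
    hg.comp (measurable_pi_lambda _ hX.measurable)
  have hind : IndepFun (fun ω => g (fun t => X t ω)) ζ μ := hζ.indep.comp hg measurable_id
  have hlaw := (indepFun_iff_map_prod_eq_prod_map_map hgm.aemeasurable
    hζ.measurable.aemeasurable).1 hind
  have hsub : Measurable fun z : ℝ≥0∞ => z - s := by fun_prop
  have e1 : (aliveMeasure ζ μ s).map (fun ω => (g (fun t => X t ω), ζ ω)) =
      (μ.map (fun ω => g (fun t => X t ω))).prod ((μ.map ζ).restrict (Ioi (s : ℝ≥0∞))) := by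
    rw [← Measure.restrict_univ (μ := μ.map (fun ω => g (fun t => X t ω))),
      Measure.prod_restrict, ← hlaw, Measure.restrict_map (hgm.prodMk hζ.measurable)
        (MeasurableSet.univ.prod measurableSet_Ioi)]
    congr 2
    simp [Set.preimage, aliveMeasure]
  have e2 : (fun ω => (g (fun t => X t ω), ζ ω - s)) =
      Prod.map id (fun z : ℝ≥0∞ => z - s) ∘ (fun ω => (g (fun t => X t ω), ζ ω)) := rfl
  rw [e2, ← Measure.map_map (by fun_prop) (hgm.prodMk hζ.measurable), e1,
    ← Measure.map_prod_map _ _ measurable_id hsub, hζ.map_sub, Measure.map_id,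
    Measure.prod_smul_right]

lemma IsIndepExpTime.map_eval_alive (hX : IsLevyProcess X μ) (hζ : IsIndepExpTime X ζ q μ)
    (s : ℝ≥0) : (aliveMeasure ζ μ s).map (X s) =
      ENNReal.ofReal (Real.exp (-(q * s))) • μ.map (X s) := by
  have := hX.isProbabilityMeasure
  have := Measure.isProbabilityMeasure_map (μ := μ) hζ.measurable.aemeasurable
  have h := hζ.map_alive hX (measurable_pi_apply s) s
  have h2 := congrArg (Measure.map Prod.fst) h
  rw [Measure.map_map measurable_fst (g := Prod.fst) (f := fun ω => (X s ω, ζ ω - s))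
    ((hX.measurable s).prodMk (hζ.measurable.sub measurable_const)), Measure.map_smul, Measure.map_fst_prod] at h2
  simpa [Function.comp_def] using h2

/-- The Markov property of the killed process: on survival up to time `s`, the past value, the
restarted path and the residual lifetime are independent, and the latter two have the
original joint law. -/
theorem IsIndepExpTime.map_restart (hX : IsLevyProcess X μ) (h0 : ∀ ω, X 0 ω = 0)
    (hζ : IsIndepExpTime X ζ q μ) (s : ℝ≥0) :
    (aliveMeasure ζ μ s).map (fun ω => (X s ω, (shift (fun t => X t ω) s, ζ ω - s))) =
      ((aliveMeasure ζ μ s).map (X s)).prod (μ.map (fun ω => ((fun t => X t ω), ζ ω))) := by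
  have := hX.isProbabilityMeasure
  have := Measure.isProbabilityMeasure_map (μ := μ) hζ.measurable.aemeasurable
  have hXm : Measurable fun ω t => X t ω := measurable_pi_lambda _ hX.measurable
  have hshift : Measurable fun x : ℝ≥0 → ℝ => shift x s :=
    measurable_pi_lambda _ fun u => (measurable_pi_apply (s + u)).sub (measurable_pi_apply s)
  have h := hζ.map_alive hX (g := fun x => (x s, shift x s))
    ((measurable_pi_apply s).prodMk hshift) s
  have hpair := (indepFun_iff_map_prod_eq_prod_map_map (hX.measurable s).aemeasurable
    (hX.measurable_shift s).aemeasurable).1 (hX.indepFun_shift h0 s)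
  have hXζ := (indepFun_iff_map_prod_eq_prod_map_map hXm.aemeasurable
    hζ.measurable.aemeasurable).1 hζ.indep
  have := Measure.isProbabilityMeasure_map (μ := μ) (hX.measurable s).aemeasurable
  have := Measure.isProbabilityMeasure_map (μ := μ) hXm.aemeasurable
  rw [hpair, hX.map_shift h0] at h
  rw [hζ.map_eval_alive hX, hXζ, Measure.prod_smul_left, ← Measure.prodAssoc_prod,
    ← Measure.map_smul, ← h, Measure.map_map MeasurableEquiv.prodAssoc.measurable]
  · rfl
  · exact ((hX.measurable s).prodMk (hX.measurable_shift s)).prodMk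
      (hζ.measurable.sub measurable_const)

end ExpFunctional

/-! ### Maximal inequalities -/

namespace ExpFunctional

section Maximal

variable {Ω : Type*} {mΩ : MeasurableSpace Ω} {μ : Measure Ω}

/-- Ottaviani's maximal inequality for partial sums of independent random variables. -/
theorem ottaviani {E : ℕ → Ω → ℝ} (hE : iIndepFun E μ) (hm : ∀ i, Measurable (E i)) {n : ℕ}
    {c : ℝ≥0∞} {u v : ℝ}
    (hc : ∀ k ≤ n, c ≤ μ {ω | -v ≤ ∑ i ∈ Finset.Ico k n, E i ω}) :
    c * μ {ω | ∃ k ≤ n, u < ∑ i ∈ Finset.range k, E i ω} ≤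
      μ {ω | u - v < ∑ i ∈ Finset.range n, E i ω} := by
  let S : ℕ → Ω → ℝ := fun k ω => ∑ i ∈ Finset.range k, E i ω
  -- `A k` is first passage above `u` at index `k`, and `B k` says that the remaining sum does not
  -- fall below `-v`. They involve disjoint blocks of variables, and together they force the final
  -- sum above `u - v`.
  let A : ℕ → Set Ω := fun k => {ω | u < S k ω ∧ ∀ j < k, S j ω ≤ u}
  let B : ℕ → Set Ω := fun k => {ω | -v ≤ ∑ i ∈ Finset.Ico k n, E i ω}
  let m : Set ℕ → MeasurableSpace Ω := fun T => ⨆ i ∈ T, MeasurableSpace.comap (E i) inferInstance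
  have hEm : ∀ (T : Set ℕ) i, i ∈ T → Measurable[m T] (E i) := fun T i hi =>
    (comap_measurable (E i)).mono
      (le_iSup₂ (f := fun i (_ : i ∈ T) => MeasurableSpace.comap (E i) inferInstance) i hi) le_rfl
  have hmle : ∀ T, m T ≤ mΩ := fun T => iSup₂_le fun i _ => (hm i).comap_le
  have hA : ∀ k, MeasurableSet[m (Iio k)] (A k) := by
    intro k
    have hS : ∀ j ≤ k, Measurable[m (Iio k)] (S j) := fun j hj =>
      Finset.measurable_fun_sum _ fun i hi => hEm _ i ((Finset.mem_range.1 hi).trans_le hj)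
    have : A k = {ω | u < S k ω} ∩ ⋂ j ∈ Finset.range k, {ω | S j ω ≤ u} := by
      ext ω
      simp [A]
    rw [this]
    refine @MeasurableSet.inter _ (m (Iio k)) _ _ ?_ (Finset.measurableSet_biInter _ fun j hj => ?_)
    · exact hS k le_rfl measurableSet_Ioi
    · exact hS j (Finset.mem_range.1 hj).le measurableSet_Iic
  have hB : ∀ k, MeasurableSet[m (Ici k)] (B k) := fun k =>
    (Finset.measurable_fun_sum (m := m (Ici k)) (Finset.Ico k n)
      fun i hi => hEm _ i (Finset.mem_Ico.1 hi).1) measurableSet_Ici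
  have hind : ∀ k, μ (A k ∩ B k) = μ (A k) * μ (B k) := by
    intro k
    have h := indep_iSup_of_disjoint (fun i => (hm i).comap_le) hE
      (S := Iio k) (T := Ici k) (Set.disjoint_left.2 fun i hi hi' => not_lt.2 (mem_Ici.1 hi') (mem_Iio.1 hi))
    exact (Indep_iff _ _ μ).1 h _ _ (hA k) (hB k)
  have hdisj : Set.PairwiseDisjoint (↑(Finset.range (n + 1)) : Set ℕ) fun k => A k ∩ B k := by
    have : ∀ i j, i < j → Disjoint (A i ∩ B i) (A j ∩ B j) := fun i j hij =>
      Set.disjoint_left.2 fun ω hi hj => not_lt.2 (hj.1.2 i hij) hi.1.1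
    intro i _ j _ hij
    rcases lt_or_gt_of_ne hij with h | h
    · exact this i j h
    · exact (this j i h).symm
  calc c * μ {ω | ∃ k ≤ n, u < ∑ i ∈ Finset.range k, E i ω}
      ≤ c * μ (⋃ k ∈ Finset.range (n + 1), A k) := by
        gcongr
        rintro ω ⟨k, hk, hu⟩
        classical
        have hex : ∃ k, u < S k ω := ⟨k, hu⟩
        simp only [mem_iUnion, Finset.mem_range]
        refine ⟨Nat.find hex, ?_, Nat.find_spec hex, fun j hj => not_lt.1 (Nat.find_min hex hj)⟩
        exact Nat.lt_succ_of_le ((Nat.find_min' hex hu).trans hk)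
    _ ≤ c * ∑ k ∈ Finset.range (n + 1), μ (A k) := by
        gcongr
        exact measure_biUnion_finset_le _ _
    _ = ∑ k ∈ Finset.range (n + 1), μ (A k) * c := by rw [Finset.mul_sum]; simp [mul_comm]
    _ ≤ ∑ k ∈ Finset.range (n + 1), μ (A k ∩ B k) := by
        refine Finset.sum_le_sum fun k hk => ?_
        rw [hind]
        gcongr
        exact hc k (Nat.lt_succ_iff.1 (Finset.mem_range.1 hk))
    _ = μ (⋃ k ∈ Finset.range (n + 1), A k ∩ B k) :=
        (measure_biUnion_finset hdisj fun k _ => (hmle _ _ (hA k)).inter (hmle _ _ (hB k))).symm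
    _ ≤ μ {ω | u - v < ∑ i ∈ Finset.range n, E i ω} := by
        refine measure_mono fun ω hω => ?_
        simp only [mem_iUnion, Finset.mem_range] at hω
        obtain ⟨k, hk, hAk, hBk⟩ := hω
        have h1 : u < ∑ i ∈ Finset.range k, E i ω := hAk.1
        have h2 : -v ≤ ∑ i ∈ Finset.Ico k n, E i ω := hBk
        have := Finset.sum_range_add_sum_Ico (fun i => E i ω) (Nat.lt_succ_iff.1 hk)
        simp only [mem_ofPred_eq]
        linarith

/-- Layer-cake integration of Ottaviani's inequality at level `log t`; the loss `v` in level becomes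
the factor `e^v`. -/
lemma lintegral_exp_max_le {E : ℕ → Ω → ℝ} (hE : iIndepFun E μ) (hm : ∀ i, Measurable (E i))
    {n : ℕ} {c : ℝ≥0∞} {v : ℝ}
    (hc : ∀ k ≤ n, c ≤ μ {ω | -v ≤ ∑ i ∈ Finset.Ico k n, E i ω}) :
    c * ∫⁻ ω, (⨆ k ∈ Finset.range (n + 1),
        ENNReal.ofReal (Real.exp (∑ i ∈ Finset.range k, E i ω))) ∂μ ≤
      ENNReal.ofReal (Real.exp v) *
        ∫⁻ ω, ENNReal.ofReal (Real.exp (∑ i ∈ Finset.range n, E i ω)) ∂μ := by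
  have hSm : ∀ k, Measurable fun ω => ∑ i ∈ Finset.range k, E i ω := fun k =>
    Finset.measurable_fun_sum _ fun i _ => hm i
  let M : Ω → ℝ := fun ω => (Finset.range (n + 1)).sup' ⟨0, by simp⟩
    fun k => ∑ i ∈ Finset.range k, E i ω
  have hM : Measurable M := by
    have := Finset.measurable_sup' (s := Finset.range (n + 1)) ⟨0, by simp⟩
      (f := fun k ω => ∑ i ∈ Finset.range k, E i ω) fun k _ => hSm k
    convert! this using 1
    ext ω
    exact (Finset.sup'_apply _ (fun k ω => ∑ i ∈ Finset.range k, E i ω) ω).symm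
  have hle : ∀ ω, (⨆ k ∈ Finset.range (n + 1),
      ENNReal.ofReal (Real.exp (∑ i ∈ Finset.range k, E i ω))) ≤
      ENNReal.ofReal (Real.exp (M ω)) := fun ω => iSup₂_le fun k hk =>
    ENNReal.ofReal_le_ofReal (Real.exp_le_exp.2
      (Finset.le_sup' (fun k => ∑ i ∈ Finset.range k, E i ω) hk))
  calc _ ≤ c * ∫⁻ ω, ENNReal.ofReal (Real.exp (M ω)) ∂μ := by
        gcongr with ω
        exact hle ω
    _ = c * ∫⁻ t in Ioi (0 : ℝ), μ {ω | t < Real.exp (M ω)} := by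
        rw [lintegral_eq_lintegral_meas_lt μ (Eventually.of_forall fun ω => (Real.exp_pos _).le)
          (Real.measurable_exp.comp hM).aemeasurable]
    _ ≤ ∫⁻ t in Ioi (0 : ℝ), μ {ω | t < Real.exp (v + ∑ i ∈ Finset.range n, E i ω)} := by
        refine (lintegral_const_mul_le _ _).trans ?_
        refine setLIntegral_mono' measurableSet_Ioi fun t ht => ?_
        have ht' : (0 : ℝ) < t := ht
        have h1 : {ω | t < Real.exp (M ω)} ⊆
            {ω | ∃ k ≤ n, Real.log t < ∑ i ∈ Finset.range k, E i ω} := by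
          intro ω hω
          have h2 : Real.log t < M ω := (Real.log_lt_iff_lt_exp ht').2 hω
          obtain ⟨k, hk, hk'⟩ := (Finset.lt_sup'_iff _).1 h2
          exact ⟨k, Nat.lt_succ_iff.1 (Finset.mem_range.1 hk), hk'⟩
        calc c * μ {ω | t < Real.exp (M ω)} ≤ _ := by gcongr
          _ ≤ μ {ω | Real.log t - v < ∑ i ∈ Finset.range n, E i ω} := ottaviani hE hm hc
          _ ≤ _ := by
            refine measure_mono fun ω (hω : Real.log t - v < _) => ?_
            have : Real.log t < v + ∑ i ∈ Finset.range n, E i ω := by linarith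
            exact (Real.log_lt_iff_lt_exp ht').1 this
    _ = ∫⁻ ω, ENNReal.ofReal (Real.exp (v + ∑ i ∈ Finset.range n, E i ω)) ∂μ := by
        have : Measurable fun ω => Real.exp (v + ∑ i ∈ Finset.range n, E i ω) :=
          Real.measurable_exp.comp ((hSm n).const_add v)
        rw [lintegral_eq_lintegral_meas_lt μ (Eventually.of_forall fun ω => (Real.exp_pos _).le)
          this.aemeasurable]
    _ = _ := by
        rw [← lintegral_const_mul' _ _ ENNReal.ofReal_ne_top]
        refine lintegral_congr fun ω => ?_
        rw [Real.exp_add, ENNReal.ofReal_mul (Real.exp_pos _).le]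

end Maximal

variable {Ω : Type*} [MeasurableSpace Ω] {μ : Measure Ω} {X : ℝ≥0 → Ω → ℝ}

lemma IsLevyProcess.measure_increment (hX : IsLevyProcess X μ) {s t : ℝ≥0} (h : s ≤ t)
    {B : Set ℝ} (hB : MeasurableSet B) :
    μ ((fun ω => X t ω - X s ω) ⁻¹' B) = μ (X (t - s) ⁻¹' B) := by
  have hm : Measurable fun ω => X t ω - X s ω := (hX.measurable t).sub (hX.measurable s)
  rw [← Measure.map_apply hm hB, hX.map_increment h, Measure.map_apply (hX.measurable _) hB]

/-- A Lévy process all of whose paths start from `0` and are right-continuous. -/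
structure IsRegularLevy (X : ℝ≥0 → Ω → ℝ) (μ : Measure Ω) : Prop where
  isLevy : IsLevyProcess X μ
  zero : ∀ ω, X 0 ω = 0
  rightCont : ∀ ω, IsRightCont fun t => X t ω

/-- Right-continuity at 0 gives convergence in probability to 0, seen through the bounded functional
`min 1 |a X_t|`, dominated convergence and Markov's inequality. -/
lemma IsRegularLevy.exists_small_time (hX : IsRegularLevy X μ) (a : ℝ) :
    ∃ N : ℕ, 0 < N ∧ ∀ t : ℝ≥0, t * N ≤ 1 → 2⁻¹ ≤ μ {ω | -1 ≤ a * X t ω} := by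
  have := hX.isLevy.isProbabilityMeasure
  have hcont : ∀ ω, Tendsto (fun t => X t ω) (𝓝 0) (𝓝 0) := by
    intro ω
    have h := hX.rightCont ω 0
    have hI : Ici (0 : ℝ≥0) = univ := by ext; simp
    rw [hI, continuousWithinAt_univ, ContinuousAt, hX.zero] at h
    exact h
  have hlim : Tendsto (fun t => ∫ ω, min 1 |a * X t ω| ∂μ) (𝓝 0) (𝓝 (∫ _, (0 : ℝ) ∂μ)) := by
    refine tendsto_integral_filter_of_dominated_convergence (fun _ => 1) ?_ ?_
      (integrable_const _) ?_
    · refine Eventually.of_forall fun t => Measurable.aestronglyMeasurable ?_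
      have := hX.isLevy.measurable t
      fun_prop
    · refine Eventually.of_forall fun t => Eventually.of_forall fun ω => ?_
      rw [Real.norm_of_nonneg (by positivity)]
      exact min_le_left _ _
    · refine Eventually.of_forall fun ω => ?_
      have h : Tendsto (fun t => min 1 |a * X t ω|) (𝓝 0) (𝓝 (min 1 |a * 0|)) :=
        tendsto_const_nhds.min ((hcont ω).const_mul a).abs
      simpa using h
  rw [integral_zero] at hlim
  have hev := hlim.eventually (gt_mem_nhds (show (0 : ℝ) < 1 / 2 by norm_num))
  have hseq : Tendsto (fun n : ℕ => (1 : ℝ≥0) / (n + 1)) atTop (𝓝 0) :=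
    tendsto_one_div_add_atTop_nhds_zero_nat (𝕜 := ℝ≥0)
  have hbas : ∃ δ : ℝ≥0, 0 < δ ∧ ∀ t < δ, ∫ ω, min 1 |a * X t ω| ∂μ < 1 / 2 := by
    obtain ⟨δ, hδ, h⟩ := (nhds_bot_basis (α := ℝ≥0)).eventually_iff.1 hev
    exact ⟨δ, hδ, fun t ht => h ht⟩
  obtain ⟨δ, hδ, hδ'⟩ := hbas
  obtain ⟨n, hn⟩ := (hseq.eventually (gt_mem_nhds hδ)).exists
  refine ⟨n + 1, Nat.succ_pos n, fun t ht => ?_⟩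
  have htδ : t < δ := by
    refine lt_of_le_of_lt ?_ hn
    rw [le_div_iff₀ (by positivity)]
    exact_mod_cast ht
  have hmeas : Measurable fun ω => min 1 |a * X t ω| := by
    have := hX.isLevy.measurable t
    fun_prop
  have hint : Integrable (fun ω => min 1 |a * X t ω|) μ := by
    refine Integrable.of_bound hmeas.aestronglyMeasurable 1 (Eventually.of_forall fun ω => ?_)
    rw [Real.norm_of_nonneg (by positivity)]
    exact min_le_left _ _
  have hmark := mul_meas_ge_le_integral_of_nonneg (μ := μ)
    (Eventually.of_forall fun ω => by positivity) hint 1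
  have hbad : μ.real {ω | -1 ≤ a * X t ω}ᶜ ≤ 1 / 2 := by
    have h1 : μ.real {ω | -1 ≤ a * X t ω}ᶜ ≤ μ.real {ω | 1 ≤ min 1 |a * X t ω|} := by
      refine measureReal_mono fun ω hω => ?_
      have hω' : a * X t ω < -1 := not_le.1 hω
      have hab : 1 ≤ |a * X t ω| := by
        rw [abs_of_neg (by linarith)]
        linarith
      exact le_min le_rfl hab
    have := hδ' t htδ
    linarith
  have hms : MeasurableSet {ω | -1 ≤ a * X t ω} :=
    measurableSet_le measurable_const ((hX.isLevy.measurable t).const_mul a)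
  rw [probReal_compl_eq_one_sub hms] at hbad
  have h2 : (1 / 2 : ℝ) ≤ μ.real {ω | -1 ≤ a * X t ω} := by linarith
  rw [← ENNReal.ofReal_toReal (measure_ne_top μ _)]
  calc (2⁻¹ : ℝ≥0∞) = ENNReal.ofReal (1 / 2) := by
        rw [one_div, ENNReal.ofReal_inv_of_pos two_pos]; simp
    _ ≤ _ := ENNReal.ofReal_le_ofReal h2

/-- Uniform lower bound over a bounded time interval. -/
lemma IsRegularLevy.exists_lower_bound (hX : IsRegularLevy X μ) (a : ℝ) :
    ∃ (c : ℝ≥0∞) (v : ℝ), c ≠ 0 ∧ c ≠ ∞ ∧ ∀ t : ℝ≥0, t ≤ 1 → c ≤ μ {ω | -v ≤ a * X t ω} := by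
  have := hX.isLevy.isProbabilityMeasure
  obtain ⟨N, hN, hsmall⟩ := hX.exists_small_time a
  -- Chain `k` independent steps of length at most `1 / N`: each one costs at most 1 in level and a
  -- factor 1/2 in probability.
  have key : ∀ (k : ℕ) (t : ℝ≥0), t * N ≤ k → (2⁻¹ : ℝ≥0∞) ^ k ≤ μ {ω | -k ≤ a * X t ω} := by
    intro k
    induction k with
    | zero =>
      intro t ht
      have : t = 0 := by
        have hN' : (N : ℝ≥0) ≠ 0 := by exact_mod_cast hN.ne'
        simpa [hN'] using ht
      subst this
      simp [hX.zero]
    | succ k ih =>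
      intro t ht
      let r : ℝ≥0 := t - 1 / N
      have hN' : (0 : ℝ≥0) < N := by exact_mod_cast hN
      have hr : r ≤ t := tsub_le_self
      have hrN : r * N ≤ k := by
        simp only [r]
        rw [tsub_mul, one_div, inv_mul_cancel₀ hN'.ne', tsub_le_iff_right]
        exact_mod_cast ht
      have htr : (t - r) * N ≤ 1 := by
        have : t - r ≤ 1 / N := tsub_tsub_le
        rwa [le_div_iff₀ hN'] at this
      have hmono : {ω | -(k : ℝ) ≤ a * X r ω} ∩ {ω | -1 ≤ a * (X t ω - X r ω)} ⊆
          {ω | -((k + 1 : ℕ) : ℝ) ≤ a * X t ω} := by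
        rintro ω ⟨h1, h2⟩
        simp only [mem_ofPred_eq] at h1 h2 ⊢
        push_cast
        nlinarith
      have hind := hX.isLevy.indep_increments.indepFun_eval_sub zero_le hr
        (Eventually.of_forall hX.zero)
      have hprod := hind.measure_inter_preimage_eq_mul {y | -(k : ℝ) ≤ a * y} {y | -1 ≤ a * y}
        (measurableSet_le measurable_const (measurable_id.const_mul a))
        (measurableSet_le measurable_const (measurable_id.const_mul a))
      have hinc : μ ((X t - X r) ⁻¹' {y | -1 ≤ a * y}) = μ {ω | -1 ≤ a * X (t - r) ω} := by
        have hms : MeasurableSet {y : ℝ | -1 ≤ a * y} :=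
          measurableSet_le measurable_const (measurable_id.const_mul a)
        exact hX.isLevy.measure_increment hr hms
      calc (2⁻¹ : ℝ≥0∞) ^ (k + 1) = 2⁻¹ ^ k * 2⁻¹ := pow_succ _ _
        _ ≤ μ {ω | -k ≤ a * X r ω} * μ {ω | -1 ≤ a * X (t - r) ω} :=
          mul_le_mul' (ih r hrN) (hsmall _ htr)
        _ = μ ({ω | -(k : ℝ) ≤ a * X r ω} ∩ {ω | -1 ≤ a * (X t ω - X r ω)}) := by
          rw [← hinc]; exact hprod.symm
        _ ≤ _ := measure_mono hmono
  refine ⟨2⁻¹ ^ N, N, by simp, by simp, fun t ht => key N t ?_⟩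
  exact mul_le_of_le_one_left zero_le ht

/-- The limit of the maxima of `e^{a X}` over the grids of mesh `1 / (n + 1)` in `[0, 1]`; it
dominates `e^{a X_t}` for all `t < 1`. -/
noncomputable def gridMax (X : ℝ≥0 → Ω → ℝ) (a : ℝ) (ω : Ω) : ℝ≥0∞ :=
  liminf (fun n : ℕ => ⨆ k ∈ Finset.range (n + 1 + 1),
    ENNReal.ofReal (Real.exp (a * X (k / (n + 1)) ω))) atTop

lemma measurable_gridMax (hX : ∀ t, Measurable (X t)) (a : ℝ) : Measurable (gridMax X a) := by
  refine Measurable.liminf fun n => ?_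
  refine Measurable.biSup _ (Finset.countable_toSet _) fun k _ => ?_
  have := hX (k / (n + 1))
  fun_prop

lemma IsRegularLevy.exp_le_gridMax (hX : IsRegularLevy X μ) (a : ℝ) {t : ℝ≥0} (ht : t < 1)
    (ω : Ω) : ENNReal.ofReal (Real.exp (a * X t ω)) ≤ gridMax X a ω := by
  have hlim : Tendsto (fun n => ENNReal.ofReal (Real.exp (a * X (gridNext n t) ω))) atTop
      (𝓝 (ENNReal.ofReal (Real.exp (a * X t ω)))) :=
    ENNReal.tendsto_ofReal ((Real.continuous_exp.tendsto _).comp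
      (((hX.rightCont ω).tendsto_gridNext t).const_mul a))
  rw [← hlim.liminf_eq]
  refine liminf_le_liminf (Eventually.of_forall fun n => ?_)
  -- Here `t < 1` is essential: rounding up to the strictly next grid point must not leave `[0, 1]`.
  have hk : ⌊((n : ℝ≥0) + 1) * t⌋₊ + 1 ∈ Finset.range (n + 1 + 1) := by
    rw [Finset.mem_range, Nat.add_lt_add_iff_right, Nat.floor_lt zero_le]
    push_cast
    exact mul_lt_of_lt_one_right (by positivity) ht
  refine le_trans (le_of_eq ?_) (le_biSup (fun k : ℕ =>
    ENNReal.ofReal (Real.exp (a * X (k / (n + 1)) ω))) hk)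
  simp [gridNext]

/-- On each grid the increments are independent and the maximal inequality applies with constants
`c`, `v` that do not depend on the mesh; Fatou's lemma then passes to the limit. -/
theorem IsRegularLevy.lintegral_gridMax_lt_top (hX : IsRegularLevy X μ) {a : ℝ}
    (ha : ∫⁻ ω, ENNReal.ofReal (Real.exp (a * X 1 ω)) ∂μ < ∞) :
    ∫⁻ ω, gridMax X a ω ∂μ < ∞ := by
  have := hX.isLevy.isProbabilityMeasure
  obtain ⟨c, v, hc0, hctop, hc⟩ := hX.exists_lower_bound a
  have hbound : ∀ n : ℕ, ∫⁻ ω, (⨆ k ∈ Finset.range (n + 1 + 1),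
      ENNReal.ofReal (Real.exp (a * X (k / (n + 1)) ω))) ∂μ ≤
      c⁻¹ * (ENNReal.ofReal (Real.exp v) * ∫⁻ ω, ENNReal.ofReal (Real.exp (a * X 1 ω)) ∂μ) := by
    intro n
    let t : ℕ → ℝ≥0 := fun k => k / (n + 1)
    have ht : Monotone t := fun i j hij => by
      simp only [t]
      gcongr
    have ht0 : t 0 = 0 := by simp [t]
    have ht1 : t (n + 1) = 1 := by
      simp only [t]
      push_cast
      exact div_self (by positivity)
    let E : ℕ → Ω → ℝ := fun i ω => a * (X (t (i + 1)) ω - X (t i) ω)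
    have hEi : iIndepFun E μ := by
      have := (hX.isLevy.indep_increments.nat ht).comp (fun _ y => a * y)
        (fun _ => measurable_id.const_mul a)
      exact this
    have hEm : ∀ i, Measurable (E i) := fun i =>
      ((hX.isLevy.measurable _).sub (hX.isLevy.measurable _)).const_mul a
    have hsum : ∀ k ω, ∑ i ∈ Finset.range k, E i ω = a * X (t k) ω := by
      intro k ω
      simp only [E]
      rw [← Finset.mul_sum, Finset.sum_range_sub fun j => X (t j) ω, ht0, hX.zero, sub_zero]
    have hsumI : ∀ k ≤ n + 1, ∀ ω, ∑ i ∈ Finset.Ico k (n + 1), E i ω =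
        a * (X (t (n + 1)) ω - X (t k) ω) := by
      intro k hk ω
      rw [Finset.sum_Ico_eq_sub _ hk, hsum, hsum]
      ring
    have hlow : ∀ k ≤ n + 1, c ≤ μ {ω | -v ≤ ∑ i ∈ Finset.Ico k (n + 1), E i ω} := by
      intro k hk
      have hms : MeasurableSet {y : ℝ | -v ≤ a * y} :=
        measurableSet_le measurable_const (measurable_id.const_mul a)
      have h1 : μ {ω | -v ≤ ∑ i ∈ Finset.Ico k (n + 1), E i ω} =
          μ {ω | -v ≤ a * X (t (n + 1) - t k) ω} := by
        simp only [hsumI k hk]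
        exact hX.isLevy.measure_increment (ht hk) hms
      rw [h1]
      exact hc _ (by rw [ht1]; exact tsub_le_self)
    have h := lintegral_exp_max_le hEi hEm hlow
    simp only [hsum, ht1] at h
    rw [← ENNReal.div_eq_inv_mul, ENNReal.le_div_iff_mul_le (Or.inl hc0) (Or.inl hctop), mul_comm]
    exact h
  calc ∫⁻ ω, gridMax X a ω ∂μ ≤ liminf (fun n : ℕ => ∫⁻ ω, (⨆ k ∈ Finset.range (n + 1 + 1),
      ENNReal.ofReal (Real.exp (a * X (k / (n + 1)) ω))) ∂μ) atTop := by
        refine lintegral_liminf_le fun n => ?_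
        refine Measurable.biSup _ (Finset.countable_toSet _) fun k _ => ?_
        have := hX.isLevy.measurable (k / (n + 1))
        fun_prop
    _ ≤ c⁻¹ * (ENNReal.ofReal (Real.exp v) *
        ∫⁻ ω, ENNReal.ofReal (Real.exp (a * X 1 ω)) ∂μ) :=
        liminf_le_of_frequently_le' (Frequently.of_forall hbound)
    _ < ∞ := ENNReal.mul_lt_top (ENNReal.inv_lt_top.2 (pos_iff_ne_zero.2 hc0))
        (ENNReal.mul_lt_top ENNReal.ofReal_lt_top ha)

end ExpFunctional

/-! ### Multiplicative functions of time -/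

namespace ExpFunctional

section Semigroup

/-- A bounded measurable function on `[0, 1)` is interval integrable away from `1`. -/
lemma intervalIntegrable_of_bound {F : ℝ → ℂ} (hF : Measurable F) {M : ℝ}
    (hM : ∀ t, 0 ≤ t → t < 1 → ‖F t‖ ≤ M) {a b : ℝ} (ha : 0 ≤ a) (ha' : a < 1) (hb : 0 ≤ b)
    (hb' : b < 1) : IntervalIntegrable F volume a b := by
  refine (intervalIntegrable_const (c := M)).mono_fun' hF.aestronglyMeasurable ?_
  refine (ae_restrict_mem measurableSet_uIoc).mono fun t ht => ?_
  rw [mem_uIoc] at ht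
  exact hM t (by rcases ht with h | h <;> linarith) (by rcases ht with h | h <;> linarith)

variable {F : ℝ → ℂ} (hmul : ∀ s t, 0 ≤ s → 0 ≤ t → F (s + t) = F s * F t) (h0 : F 0 = 1)
  (hF : Measurable F) {M : ℝ} (hM : ∀ t, 0 ≤ t → t < 1 → ‖F t‖ ≤ M)
  (hrc : ∀ t, 0 ≤ t → t < 1 → ContinuousWithinAt F (Ici t) t)

include hF hM hrc in
lemma hasDerivWithinAt_integral_of_rightCont {t : ℝ} (ht : 0 ≤ t) (ht' : t < 1) :
    HasDerivWithinAt (fun u => ∫ x in (0 : ℝ)..u, F x) (F t) (Ici t) t :=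
  intervalIntegral.integral_hasDerivWithinAt_right
    (intervalIntegrable_of_bound hF hM le_rfl one_pos ht ht')
    (hF.stronglyMeasurable.stronglyMeasurableAtFilter)
    ((hrc t ht ht').mono Ioi_subset_Ici_self)

include h0 hF hM hrc in
-- The primitive of `F` has right derivative `F 0 = 1` at 0. The bound 1/2 on `c` keeps `t + c`
-- inside `[0, 1)` for all `t < 1/2`.
lemma exists_integral_ne_zero :
    ∃ c : ℝ, 0 < c ∧ c < 1 / 2 ∧ ∫ x in (0 : ℝ)..c, F x ≠ 0 := by
  have hd := hasDerivWithinAt_integral_of_rightCont hF hM hrc le_rfl one_pos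
  have hne := hd.eventually_ne (c := 0) (by rw [h0]; exact one_ne_zero)
  have hset : Ici (0 : ℝ) \ {0} = Ioi 0 := by
    ext x
    simp only [Set.mem_sdiff, mem_Ici, mem_singleton_iff, mem_Ioi]
    exact ⟨fun h => lt_of_le_of_ne h.1 (Ne.symm h.2), fun h => ⟨h.le, h.ne'⟩⟩
  rw [hset] at hne
  obtain ⟨c, h1, h2, h3⟩ :=
    (hne.and (Ioo_mem_nhdsGT (show (0 : ℝ) < 1 / 2 by norm_num))).exists
  exact ⟨c, h2, h3, h1⟩

include hmul h0 hF hM hrc in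
/-- A multiplicative function that is right-continuous and bounded near `0` is an exponential. -/
theorem eq_exp_of_mul {c : ℝ} (hc : 0 < c) (hc' : c < 1 / 2)
    (hne : ∫ x in (0 : ℝ)..c, F x ≠ 0) {t : ℝ} (ht : 0 ≤ t) :
    F t = Complex.exp (t * ((F c - 1) / ∫ x in (0 : ℝ)..c, F x)) := by
  set G : ℝ → ℂ := fun u => ∫ x in (0 : ℝ)..u, F x with hG
  set κ : ℂ := (F c - 1) / G c with hκ
  have hGd : ∀ t, 0 ≤ t → t < 1 → HasDerivWithinAt G (F t) (Ici t) t := fun t ht ht' =>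
    hasDerivWithinAt_integral_of_rightCont hF hM hrc ht ht'
  have hint : ∀ a b, 0 ≤ a → a < 1 → 0 ≤ b → b < 1 → IntervalIntegrable F volume a b :=
    fun a b ha ha' hb hb' => intervalIntegrable_of_bound hF hM ha ha' hb hb'
  -- Averaging `F (t + x) = F t * F x` over `x` in `[0, c]` writes `F` through its own primitive.
  -- This gains regularity: `F` becomes continuous with a right derivative solving F' = κF.
  have hFG : ∀ t, 0 ≤ t → t < 1 / 2 → F t = (G (t + c) - G t) / G c := by
    intro t ht ht'
    rw [eq_div_iff hne]
    have h1 : G (t + c) - G t = ∫ x in t..(t + c), F x := by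
      have := intervalIntegral.integral_add_adjacent_intervals
        (hint 0 t le_rfl one_pos ht (by linarith))
        (hint t (t + c) ht (by linarith) (by linarith) (by linarith))
      simp only [hG]
      rw [← this]
      ring
    have h2 : ∫ x in (0 : ℝ)..c, F (t + x) = ∫ x in t..(t + c), F x := by
      rw [intervalIntegral.integral_comp_add_left, add_zero]
    have h3 : ∫ x in (0 : ℝ)..c, F (t + x) = F t * G c := by
      simp only [hG]
      rw [← intervalIntegral.integral_const_mul]
      refine intervalIntegral.integral_congr fun x hx => ?_
      rw [uIcc_of_le hc.le] at hx
      exact hmul t x ht hx.1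
    rw [h1, ← h2, h3]
  have hFd : ∀ t, 0 ≤ t → t < 1 / 2 → HasDerivWithinAt F (F t * κ) (Ici t) t := by
    intro t ht ht'
    have h1 : HasDerivWithinAt (fun u => G (u + c)) (F (t + c)) (Ici t) t := by
      have h := hGd (t + c) (by linarith) (by linarith)
      have h' := h.scomp t (((hasDerivAt_id t).add_const c).hasDerivWithinAt (s := Ici t))
        (fun u hu => by simpa using hu)
      simpa [Function.comp_def] using h'
    have h2 := (h1.sub (hGd t ht (by linarith))).div_const (G c)
    have h3 : (F (t + c) - F t) / G c = F t * κ := by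
      rw [hmul t c ht hc.le, hκ]
      ring
    rw [h3] at h2
    refine h2.congr_of_eventuallyEq ?_ (hFG t ht ht')
    filter_upwards [Ico_mem_nhdsGE ht'] with u hu
    exact hFG u (ht.trans hu.1) hu.2
  have hGc : ContinuousOn G (Icc 0 (3 / 4)) := by
    have := intervalIntegral.continuousOn_primitive_interval (μ := volume) (f := F) (a := 0)
      (b := 3 / 4) ?_
    · rwa [uIcc_of_le (by norm_num)] at this
    · have := hint 0 (3 / 4) le_rfl one_pos (by norm_num) (by norm_num)
      rwa [intervalIntegrable_iff'] at this
  have hFc : ContinuousOn F (Icc 0 (1 / 4)) := by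
    have h1 : ContinuousOn (fun t => (G (t + c) - G t) / G c) (Icc 0 (1 / 4)) := by
      refine ContinuousOn.div_const (ContinuousOn.sub ?_ (hGc.mono ?_)) _
      · refine hGc.comp (by fun_prop) fun t ht => ⟨by linarith [ht.1], by linarith [ht.2]⟩
      · exact Icc_subset_Icc le_rfl (by norm_num)
    exact h1.congr fun t ht => hFG t ht.1 (by linarith [ht.2])
  have hsmall : ∀ t ∈ Icc (0 : ℝ) (1 / 4), F t = Complex.exp (t * κ) := by
    have hexp : ∀ t : ℝ, HasDerivAt (fun t : ℝ => Complex.exp (-(t * κ)))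
        (Complex.exp (-(t * κ)) * -κ) t := by
      intro t
      have h1 : HasDerivAt (fun t : ℝ => -((t : ℂ) * κ)) (-κ) t := by
        have := ((Complex.ofRealCLM.hasDerivAt (x := t)).mul_const κ).fun_neg
        simpa using this
      exact h1.cexp
    have hconst := constant_of_has_deriv_right_zero
      (f := fun t : ℝ => F t * Complex.exp (-(t * κ))) (a := 0) (b := 1 / 4)
      (hFc.mul (by fun_prop)) fun t ht => by
        have h := (hFd t ht.1 (by linarith [ht.2])).mul ((hexp t).hasDerivWithinAt (s := Ici t))
        refine h.congr_deriv ?_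
        ring
    intro t ht
    have h := hconst t ht
    simp only [h0, Complex.ofReal_zero, zero_mul, neg_zero, Complex.exp_zero, mul_one] at h
    rw [Complex.exp_neg] at h
    rwa [mul_inv_eq_one₀ (Complex.exp_ne_zero _)] at h
  -- Multiplicativity carries the formula from `[0, 1/4]` to all times, by dividing `t` into
  -- sufficiently many equal parts.
  have hpow : ∀ (n : ℕ) (s : ℝ), 0 ≤ s → F (n * s) = F s ^ n := by
    intro n s hs
    induction n with
    | zero => simp [h0]
    | succ n ih =>
      rw [pow_succ, ← ih, ← hmul _ _ (by positivity) hs]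
      push_cast
      ring_nf
  obtain ⟨n, hn⟩ := exists_nat_gt (4 * t)
  have hn0 : (0 : ℝ) < n := by linarith
  have h1 := hpow n (t / n) (by positivity)
  rw [mul_div_cancel₀ _ hn0.ne'] at h1
  rw [h1, hsmall (t / n) ⟨by positivity, by rw [div_le_iff₀ hn0]; linarith⟩, ← Complex.exp_nat_mul]
  congr 1
  push_cast
  have : (n : ℂ) ≠ 0 := by exact_mod_cast hn0.ne'
  field_simp

end Semigroup

/-- The exponent of a multiplicative semigroup is determined by the semigroup. -/
lemma exponent_unique {κ κ' : ℂ}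
    (h : ∀ t : ℝ≥0, Complex.exp (t * κ) = Complex.exp (t * κ')) : κ = κ' := by
  set u := κ - κ' with hu
  have h1 : ∀ t : ℝ≥0, Complex.exp (t * u) = 1 := fun t => by
    rw [hu, mul_sub, Complex.exp_sub, h t, div_self (Complex.exp_ne_zero _)]
  -- A time so small that `t * u` lies in the strip where the principal logarithm inverts the
  -- exponential, which removes the 2πi ambiguity.
  set t : ℝ≥0 := ⟨1 / (1 + ‖u‖), by positivity⟩ with ht
  have ht0 : (t : ℝ) = 1 / (1 + ‖u‖) := rfl
  have hpos : 0 < (t : ℝ) := by rw [ht0]; positivity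
  have hnorm : ‖(t : ℂ) * u‖ ≤ 1 := by
    rw [norm_mul, show ‖(t : ℂ)‖ = t by
      rw [show (t : ℂ) = ((t : ℝ) : ℂ) from rfl, Complex.norm_real, Real.norm_of_nonneg hpos.le],
      ht0, div_mul_eq_mul_div, one_mul, div_le_one (by positivity)]
    linarith
  have him := abs_le.1 ((Complex.abs_im_le_norm _).trans hnorm)
  have hlog := Complex.log_exp (x := (t : ℂ) * u) (by linarith [Real.pi_gt_three])
    (by linarith [Real.pi_gt_three])
  rw [h1, Complex.log_one] at hlog
  have : (t : ℂ) ≠ 0 := by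
    have : ((t : ℝ) : ℂ) ≠ 0 := by exact_mod_cast hpos.ne'
    exact this
  have hu0 : u = 0 := by
    rcases mul_eq_zero.1 hlog.symm with h | h
    · exact absurd h this
    · exact h
  exact sub_eq_zero.1 hu0

/-! ### Uniqueness from boundary values -/

section Reflection

/-- The open square with centre `c` and side length `2 d`. -/
def openSquare (c : ℂ) (d : ℝ) : Set ℂ := Ioo (c.re - d) (c.re + d) ×ℂ Ioo (c.im - d) (c.im + d)

/-- A function that is continuous on a closed square, holomorphic inside and zero on the right side
vanishes at the centre. -/
lemma eq_zero_of_square {g : ℂ → ℂ} {c : ℂ} {d : ℝ} (hd : 0 < d)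
    (hg : DiffContOnCl ℂ g (openSquare c d))
    (hzero : ∀ z ∈ closure (openSquare c d), z.re = c.re + d → g z = 0) : g c = 0 := by
  have hcl : closure (openSquare c d) =
      Icc (c.re - d) (c.re + d) ×ℂ Icc (c.im - d) (c.im + d) := by
    rw [openSquare, Complex.closure_reProdIm, closure_Ioo (by linarith), closure_Ioo (by linarith)]
  have hopen : IsOpen (openSquare c d) := isOpen_Ioo.reProdIm isOpen_Ioo
  let R : ℂ → ℂ → ℂ := fun w z => c + w * (z - c)
  have hre : ∀ k : ℕ, k < 4 → ∀ z, z ∈ openSquare c d → R (Complex.I ^ k) z ∈ openSquare c d := by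
    intro k hk z hz
    simp only [openSquare, Complex.mem_reProdIm, mem_Ioo] at hz ⊢
    interval_cases k <;> simp [R, pow_succ] <;>
      refine ⟨⟨?_, ?_⟩, ?_, ?_⟩ <;> linarith [hz.1.1, hz.1.2, hz.2.1, hz.2.2]
  have hcts : ∀ w : ℂ, Continuous (R w) := fun w => by fun_prop
  have hdiff : ∀ w : ℂ, Differentiable ℂ (R w) := fun w => by fun_prop
  have hcomp : ∀ k : ℕ, k < 4 → DiffContOnCl ℂ (fun z => g (R (Complex.I ^ k) z))
      (openSquare c d) := fun k hk =>
    hg.comp (hdiff _).diffContOnCl (fun z hz => hre k hk z hz)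
  have hreC : ∀ k : ℕ, k < 4 → ∀ z, z ∈ closure (openSquare c d) →
      R (Complex.I ^ k) z ∈ closure (openSquare c d) := fun k hk =>
    (show MapsTo (R (Complex.I ^ k)) _ _ from hre k hk).closure (hcts _)
  -- The product of `g` over the four quarter turns about `c`. Each side of the square is carried by
  -- one of the turns to the side where `g` vanishes, so `P` vanishes on the whole frontier; by the
  -- maximum principle `P c = g c ^ 4` is zero.
  let P : ℂ → ℂ := fun z => g (R (Complex.I ^ 0) z) * g (R (Complex.I ^ 1) z) *
    (g (R (Complex.I ^ 2) z) * g (R (Complex.I ^ 3) z))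
  have hP : DiffContOnCl ℂ P (openSquare c d) :=
    ⟨(((hcomp 0 (by norm_num)).1.mul (hcomp 1 (by norm_num)).1).mul
        ((hcomp 2 (by norm_num)).1.mul (hcomp 3 (by norm_num)).1)),
      (((hcomp 0 (by norm_num)).2.mul (hcomp 1 (by norm_num)).2).mul
        ((hcomp 2 (by norm_num)).2.mul (hcomp 3 (by norm_num)).2))⟩
  have hbdd : Bornology.IsBounded (openSquare c d) :=
    (Metric.isBounded_Ioo _ _).reProdIm (Metric.isBounded_Ioo _ _)
  have hfr : ∀ z ∈ frontier (openSquare c d), ‖P z‖ ≤ 0 := by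
    intro z hz
    have hzc := frontier_subset_closure hz
    have hzn : z ∉ openSquare c d := fun h => hz.2 (by rwa [hopen.interior_eq])
    have hz' := hzc
    rw [hcl, Complex.mem_reProdIm] at hz'
    obtain ⟨⟨h1, h2⟩, h3, h4⟩ := hz'
    have hside : z.re = c.re + d ∨ z.im = c.im - d ∨ z.re = c.re - d ∨ z.im = c.im + d := by
      by_contra! hcon
      refine hzn ⟨⟨lt_of_le_of_ne h1 (Ne.symm hcon.2.2.1), lt_of_le_of_ne h2 hcon.1⟩,
        lt_of_le_of_ne h3 (Ne.symm hcon.2.1), lt_of_le_of_ne h4 hcon.2.2.2⟩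
    have key : ∀ k : ℕ, k < 4 → (R (Complex.I ^ k) z).re = c.re + d →
        g (R (Complex.I ^ k) z) = 0 := fun k hk h => hzero _ (hreC k hk z hzc) h
    rw [norm_le_zero_iff]
    simp only [P]
    rcases hside with h | h | h | h
    · rw [key 0 (by norm_num) (by simp [R, h])]
      simp
    · rw [key 1 (by norm_num) (by simp [R, h])]
      simp
    · rw [key 2 (by norm_num) (by simp [R, h])]
      simp
    · rw [key 3 (by norm_num) (by simp [R, h, pow_succ])]
      simp
  have hc : c ∈ closure (openSquare c d) := by
    rw [hcl, Complex.mem_reProdIm]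
    exact ⟨⟨by linarith, by linarith⟩, by linarith, by linarith⟩
  have h := Complex.norm_le_of_forall_mem_frontier_norm_le hbdd hP hfr hc
  rw [norm_le_zero_iff] at h
  simp only [P, R, sub_self, mul_zero, add_zero] at h
  simpa using h

/-- A function that is continuous on the closed strip `0 ≤ Re z ≤ b`, holomorphic inside and zero
on the imaginary axis vanishes on the strip. -/
theorem eq_zero_of_strip {g : ℂ → ℂ} {b : ℝ} (hb : 0 < b)
    (hg : DifferentiableOn ℂ g {z | z.re ∈ Ioo 0 b}) (hgc : ContinuousOn g {z | z.re ∈ Icc 0 b})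
    (hzero : ∀ z : ℂ, z.re = 0 → g z = 0) {z : ℂ} (hz : z.re ∈ Icc 0 b) : g z = 0 := by
  have hU : IsOpen {z : ℂ | z.re ∈ Ioo 0 b} := isOpen_Ioo.preimage Complex.continuous_re
  -- The square about `c` of half side `c.re` touches the imaginary axis and stays to the left of
  -- `Re z = b`. The map `z ↦ -z` turns the touching side into the right one. The identity theorem
  -- and continuity then reach the rest of the strip.
  have hsmall : ∀ c : ℂ, 0 < c.re → c.re < b / 2 → g c = 0 := by
    intro c hc hc'
    have hsq : openSquare (-c) c.re ⊆ {z | (-z).re ∈ Ioo 0 b} := by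
      rintro z ⟨⟨h1, h2⟩, -⟩
      simp only [Complex.neg_re] at h1 h2
      simp only [mem_ofPred_eq, Complex.neg_re, mem_Ioo]
      constructor <;> linarith
    have hcl : closure (openSquare (-c) c.re) ⊆ {z | (-z).re ∈ Icc 0 b} := by
      refine closure_minimal (hsq.trans fun z hz => ⟨hz.1.le, hz.2.le⟩) ?_
      exact isClosed_Icc.preimage (Complex.continuous_re.comp continuous_neg)
    have hdc : DiffContOnCl ℂ (fun z => g (-z)) (openSquare (-c) c.re) :=
      ⟨hg.comp (by fun_prop) hsq, hgc.comp (by fun_prop) hcl⟩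
    have h := eq_zero_of_square hc hdc fun z _ hz => hzero _ (by simp [hz])
    simpa using h
  have han : AnalyticOnNhd ℂ g {z : ℂ | z.re ∈ Ioo 0 b} := hg.analyticOnNhd hU
  have hconn : IsPreconnected {z : ℂ | z.re ∈ Ioo 0 b} :=
    ((convex_Ioo 0 b).linear_preimage Complex.reLm).isPreconnected
  have hb4 : (((b / 4 : ℝ) : ℂ)) ∈ {z : ℂ | z.re ∈ Ioo 0 b} := by
    simp only [mem_ofPred_eq, Complex.ofReal_re, mem_Ioo]
    constructor <;> linarith
  have hev : g =ᶠ[𝓝 ((b / 4 : ℝ) : ℂ)] 0 := by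
    have hopen : IsOpen {z : ℂ | z.re ∈ Ioo 0 (b / 2)} := isOpen_Ioo.preimage Complex.continuous_re
    filter_upwards [hopen.mem_nhds (show ((b / 4 : ℝ) : ℂ) ∈ {z : ℂ | z.re ∈ Ioo 0 (b / 2)} by
      simp only [mem_ofPred_eq, Complex.ofReal_re, mem_Ioo]
      constructor <;> linarith)] with z hz
    exact hsmall z hz.1 hz.2
  have hint : EqOn g 0 {z : ℂ | z.re ∈ Ioo 0 b} :=
    han.eqOn_zero_of_preconnected_of_eventuallyEq_zero hconn hb4 hev
  have hcl : closure {z : ℂ | z.re ∈ Ioo 0 b} = {z | z.re ∈ Icc 0 b} := by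
    have := Complex.closure_preimage_re (Ioo 0 b)
    rw [closure_Ioo hb.ne] at this
    exact this
  have := hint.of_subset_closure hgc continuousOn_const
    (fun z hz => ⟨hz.1.le, hz.2.le⟩) hcl.ge
  exact this hz

end Reflection

end ExpFunctional

/-! ### Laplace and characteristic exponents on the strip -/

namespace ExpFunctional

variable {Ω : Type*} [MeasurableSpace Ω] {μ : Measure Ω} {X : ℝ≥0 → Ω → ℝ}

lemma lintegral_exp_lt_top_iff {Y : Ω → ℝ} (hY : Measurable Y) (a : ℝ) :
    ∫⁻ ω, ENNReal.ofReal (Real.exp (a * Y ω)) ∂μ < ∞ ↔ a ∈ integrableExpSet Y μ := by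
  have hm : Measurable fun ω => Real.exp (a * Y ω) := by fun_prop
  have : a ∈ integrableExpSet Y μ ↔ Integrable (fun ω => Real.exp (a * Y ω)) μ := Iff.rfl
  rw [this, Integrable, and_iff_right hm.aestronglyMeasurable,
    hasFiniteIntegral_iff_ofReal (Eventually.of_forall fun ω => (Real.exp_pos _).le)]

/-- A common integrable bound for `e^{a X_t}` with `t < 1` and `a` in a compact interval of
exponents with finite exponential moment. -/
lemma IsRegularLevy.exists_bound (hX : IsRegularLevy X μ) {a₁ a₂ : ℝ}
    (h₁ : a₁ ∈ integrableExpSet (X 1) μ) (h₂ : a₂ ∈ integrableExpSet (X 1) μ) :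
    ∃ B : Ω → ℝ, Integrable B μ ∧
      ∀ᵐ ω ∂μ, ∀ t : ℝ≥0, t < 1 → ∀ a ∈ Icc a₁ a₂, Real.exp (a * X t ω) ≤ B ω := by
  have hm := hX.isLevy.measurable
  have hfin : ∀ a ∈ integrableExpSet (X 1) μ, ∫⁻ ω, gridMax X a ω ∂μ ≠ ∞ := fun a ha =>
    (hX.lintegral_gridMax_lt_top ((lintegral_exp_lt_top_iff (hm 1) a).2 ha)).ne
  refine ⟨fun ω => (gridMax X a₁ ω).toReal + (gridMax X a₂ ω).toReal,
    (integrable_toReal_of_lintegral_ne_top (measurable_gridMax hm a₁).aemeasurable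
      (hfin a₁ h₁)).add (integrable_toReal_of_lintegral_ne_top
      (measurable_gridMax hm a₂).aemeasurable (hfin a₂ h₂)), ?_⟩
  filter_upwards [ae_lt_top (measurable_gridMax hm a₁) (hfin a₁ h₁),
    ae_lt_top (measurable_gridMax hm a₂) (hfin a₂ h₂)] with ω hω₁ hω₂ t ht a ha
  have hb : ∀ b, gridMax X b ω < ∞ → Real.exp (b * X t ω) ≤ (gridMax X b ω).toReal := fun b hb =>
    (ENNReal.ofReal_le_iff_le_toReal hb.ne).1 (hX.exp_le_gridMax b ht ω)
  rcases le_total 0 (X t ω) with h | h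
  · have : Real.exp (a * X t ω) ≤ Real.exp (a₂ * X t ω) :=
      Real.exp_le_exp.2 (mul_le_mul_of_nonneg_right ha.2 h)
    linarith [hb a₂ hω₂, ENNReal.toReal_nonneg (a := gridMax X a₁ ω)]
  · have : Real.exp (a * X t ω) ≤ Real.exp (a₁ * X t ω) :=
      Real.exp_le_exp.2 (mul_le_mul_of_nonpos_right ha.1 h)
    linarith [hb a₁ hω₁, ENNReal.toReal_nonneg (a := gridMax X a₂ ω)]

lemma IsRegularLevy.lintegral_exp_add (hX : IsRegularLevy X μ) (a : ℝ) (s t : ℝ≥0) :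
    ∫⁻ ω, ENNReal.ofReal (Real.exp (a * X (s + t) ω)) ∂μ =
      (∫⁻ ω, ENNReal.ofReal (Real.exp (a * X s ω)) ∂μ) *
        ∫⁻ ω, ENNReal.ofReal (Real.exp (a * X t ω)) ∂μ := by
  have hm := hX.isLevy.measurable
  have hg : Measurable fun y : ℝ => ENNReal.ofReal (Real.exp (a * y)) := by fun_prop
  have hind := (hX.isLevy.indep_increments.indepFun_eval_sub (t := s + t) zero_le le_self_add
    (Eventually.of_forall hX.zero)).comp hg hg
  have h := lintegral_mul_eq_lintegral_mul_lintegral_of_indepFun''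
    (hg.comp (hm s)).aemeasurable (hg.comp ((hm (s + t)).sub (hm s))).aemeasurable hind
  have hlaw := (hX.isLevy.stationary_increments s t).comp hg
  rw [show ∫⁻ ω, ENNReal.ofReal (Real.exp (a * X t ω)) ∂μ = _ from hlaw.lintegral_eq.symm]
  refine Eq.trans (lintegral_congr fun ω => ?_) h
  simp only [Function.comp, Pi.sub_apply]
  rw [← ENNReal.ofReal_mul (Real.exp_pos _).le, ← Real.exp_add]
  congr 2
  ring

lemma IsRegularLevy.complexMGF_add (hX : IsRegularLevy X μ) (w : ℂ) (s t : ℝ≥0) :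
    complexMGF (X (s + t)) μ w = complexMGF (X s) μ w * complexMGF (X t) μ w := by
  have hm := hX.isLevy.measurable
  have hg : Measurable fun y : ℝ => Complex.exp (w * y) := by fun_prop
  have hind := (hX.isLevy.indep_increments.indepFun_eval_sub (t := s + t) zero_le le_self_add
    (Eventually.of_forall hX.zero)).comp hg hg
  have h := hind.integral_fun_mul_eq_mul_integral
    (hg.comp (hm s)).aestronglyMeasurable (hg.comp ((hm (s + t)).sub (hm s))).aestronglyMeasurable
  have hlaw := (hX.isLevy.stationary_increments s t).comp hg
  have e : complexMGF (X t) μ w =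
      ∫ ω, ((fun y : ℝ => Complex.exp (w * y)) ∘ (X (s + t) - X s)) ω ∂μ :=
    hlaw.integral_eq.symm
  rw [e, complexMGF]
  refine Eq.trans (integral_congr_ae (Eventually.of_forall fun ω => ?_)) h
  simp only [Function.comp, Pi.sub_apply]
  rw [← Complex.exp_add]
  congr 1
  push_cast
  ring

lemma IsRegularLevy.measurable_uncurry (hX : IsRegularLevy X μ) :
    Measurable fun p : ℝ≥0 × Ω => X p.1 p.2 :=
  measurable_uncurry_of_isRightCont hX.isLevy.measurable hX.rightCont

lemma IsRegularLevy.measurable_complexMGF (hX : IsRegularLevy X μ) (w : ℂ) :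
    Measurable fun t : ℝ≥0 => complexMGF (X t) μ w := by
  have := hX.isLevy.isProbabilityMeasure
  have h1 := hX.measurable_uncurry
  have h2 : Measurable fun p : ℝ≥0 × Ω => Complex.exp (w * X p.1 p.2) := by fun_prop
  exact (h2.stronglyMeasurable.integral_prod_right' (ν := μ)).measurable

lemma norm_exp_mul_ofReal (w : ℂ) (x : ℝ) : ‖Complex.exp (w * x)‖ = Real.exp (w.re * x) := by
  rw [Complex.norm_exp]
  simp

/-- Path right-continuity passes through the expectation because the bound of `exists_bound` is
uniform over times below 1. -/
lemma IsRegularLevy.rightCont_complexMGF (hX : IsRegularLevy X μ) {w : ℂ}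
    (hw : w.re ∈ integrableExpSet (X 1) μ) {t : ℝ≥0} (ht : t < 1) :
    ContinuousWithinAt (fun t => complexMGF (X t) μ w) (Ici t) t := by
  have hm := hX.isLevy.measurable
  obtain ⟨B, hB, hBt⟩ := hX.exists_bound hw hw
  refine continuousWithinAt_of_dominated (bound := B) ?_ ?_ hB ?_
  · refine Eventually.of_forall fun s => Measurable.aestronglyMeasurable ?_
    have := hm s
    fun_prop
  · filter_upwards [mem_nhdsWithin_of_mem_nhds (gt_mem_nhds ht)] with s hs
    filter_upwards [hBt] with ω hω
    rw [norm_exp_mul_ofReal]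
    exact hω s hs _ ⟨le_rfl, le_rfl⟩
  · refine Eventually.of_forall fun ω => ?_
    have h := hX.rightCont ω t
    have h2 : Continuous fun y : ℝ => Complex.exp (w * y) := by fun_prop
    exact h2.continuousAt.comp_continuousWithinAt h

/-- Near each point of the strip, the real parts stay in a compact interval of admissible
exponents. -/
lemma exists_local_interval {J : Set ℝ} {a : ℝ} (ha : a ∈ J) :
    ∃ a₁ ∈ J, ∃ a₂ ∈ J, ∀ᶠ b in 𝓝[J] a, b ∈ Icc a₁ a₂ := by
  have h1 : ∃ a₁ ∈ J, ∀ᶠ b in 𝓝[J] a, a₁ ≤ b := by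
    -- If `a` is the left end point of `J`, it bounds its own relative neighbourhood, so closed ends
    -- of the strip are included.
    by_cases h : ∃ a₁ ∈ J, a₁ < a
    · obtain ⟨a₁, h1, h2⟩ := h
      exact ⟨a₁, h1, mem_nhdsWithin_of_mem_nhds (Filter.mem_of_superset (lt_mem_nhds h2)
        fun b (hb : a₁ < b) => hb.le)⟩
    · push Not at h
      exact ⟨a, ha, eventually_mem_nhdsWithin.mono fun b hb => h b hb⟩
  have h2 : ∃ a₂ ∈ J, ∀ᶠ b in 𝓝[J] a, b ≤ a₂ := by
    by_cases h : ∃ a₂ ∈ J, a < a₂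
    · obtain ⟨a₂, h1, h2⟩ := h
      exact ⟨a₂, h1, mem_nhdsWithin_of_mem_nhds (Filter.mem_of_superset (gt_mem_nhds h2)
        fun b (hb : b < a₂) => hb.le)⟩
    · push Not at h
      exact ⟨a, ha, eventually_mem_nhdsWithin.mono fun b hb => h b hb⟩
  obtain ⟨a₁, h1, h1'⟩ := h1
  obtain ⟨a₂, h2, h2'⟩ := h2
  exact ⟨a₁, h1, a₂, h2, h1'.and h2'⟩

lemma exists_local_interval_re {J : Set ℝ} {w : ℂ} (hw : w.re ∈ J) :
    ∃ a₁ ∈ J, ∃ a₂ ∈ J, ∀ᶠ z in 𝓝[{z | z.re ∈ J}] w, z.re ∈ Icc a₁ a₂ := by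
  obtain ⟨a₁, h1, a₂, h2, h⟩ := exists_local_interval hw
  refine ⟨a₁, h1, a₂, h2, ?_⟩
  have ht : Tendsto Complex.re (𝓝[{z | z.re ∈ J}] w) (𝓝[J] w.re) :=
    Complex.continuous_re.continuousWithinAt.tendsto_nhdsWithin fun z hz => hz
  exact ht.eventually h

lemma IsRegularLevy.continuousOn_complexMGF (hX : IsRegularLevy X μ) {t : ℝ≥0} (ht : t < 1) :
    ContinuousOn (complexMGF (X t) μ) {w | w.re ∈ integrableExpSet (X 1) μ} := by
  intro w hw
  have hm := hX.isLevy.measurable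
  obtain ⟨a₁, h1, a₂, h2, hloc⟩ := exists_local_interval_re hw
  obtain ⟨B, hB, hBt⟩ := hX.exists_bound h1 h2
  refine continuousWithinAt_of_dominated (bound := B) ?_ ?_ hB ?_
  · refine Eventually.of_forall fun s => Measurable.aestronglyMeasurable ?_
    have := hm t
    fun_prop
  · filter_upwards [hloc] with z hz
    filter_upwards [hBt] with ω hω
    rw [norm_exp_mul_ofReal]
    exact hω t ht _ hz
  · refine Eventually.of_forall fun ω => Continuous.continuousWithinAt ?_
    fun_prop

lemma IsRegularLevy.exists_norm_complexMGF_le (hX : IsRegularLevy X μ) {a₁ a₂ : ℝ}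
    (h₁ : a₁ ∈ integrableExpSet (X 1) μ) (h₂ : a₂ ∈ integrableExpSet (X 1) μ) :
    ∃ M : ℝ, ∀ t : ℝ≥0, t < 1 → ∀ w : ℂ, w.re ∈ Icc a₁ a₂ → ‖complexMGF (X t) μ w‖ ≤ M := by
  obtain ⟨B, hB, hBt⟩ := hX.exists_bound h₁ h₂
  refine ⟨∫ ω, B ω ∂μ, fun t ht w hw => norm_integral_le_of_norm_le hB ?_⟩
  filter_upwards [hBt] with ω hω
  rw [norm_exp_mul_ofReal]
  exact hω t ht _ hw

/-- The integral of the moment generating function over the time interval `[0, c]`. -/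
noncomputable def mgfTimeIntegral (X : ℝ≥0 → Ω → ℝ) (μ : Measure Ω) (c : ℝ) (w : ℂ) : ℂ :=
  ∫ s in (0 : ℝ)..c, complexMGF (X s.toNNReal) μ w

lemma IsRegularLevy.continuousOn_mgfTimeIntegral (hX : IsRegularLevy X μ) {c : ℝ} (hc : 0 < c)
    (hc' : c < 1) :
    ContinuousOn (mgfTimeIntegral X μ c) {w | w.re ∈ integrableExpSet (X 1) μ} := by
  intro w hw
  obtain ⟨a₁, h1, a₂, h2, hloc⟩ := exists_local_interval_re hw
  obtain ⟨M, hM⟩ := hX.exists_norm_complexMGF_le h1 h2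
  have hlt : ∀ s ∈ uIoc 0 c, s.toNNReal < 1 := fun s hs => by
    rw [uIoc_of_le hc.le] at hs
    rw [← Real.toNNReal_one]
    exact (Real.toNNReal_lt_toNNReal_iff one_pos).2 (hs.2.trans_lt hc')
  refine intervalIntegral.continuousWithinAt_of_dominated_interval (bound := fun _ => M) ?_ ?_
    intervalIntegrable_const ?_
  · refine Eventually.of_forall fun z => Measurable.aestronglyMeasurable ?_
    exact (hX.measurable_complexMGF z).comp measurable_real_toNNReal
  · filter_upwards [hloc] with z hz
    exact Eventually.of_forall fun s hs => hM _ (hlt s hs) z hz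
  · exact Eventually.of_forall fun s hs => hX.continuousOn_complexMGF (hlt s hs) w hw

/-- On the strip, the moment generating function is exponential in time. -/
theorem IsRegularLevy.complexMGF_eq_exp (hX : IsRegularLevy X μ) {w : ℂ}
    (hw : w.re ∈ integrableExpSet (X 1) μ) :
    (∃ c : ℝ, 0 < c ∧ c < 1 / 2 ∧ mgfTimeIntegral X μ c w ≠ 0) ∧
    ∀ c : ℝ, 0 < c → c < 1 / 2 → mgfTimeIntegral X μ c w ≠ 0 → ∀ t : ℝ≥0,
      complexMGF (X t) μ w = Complex.exp (t *
        ((complexMGF (X c.toNNReal) μ w - 1) / mgfTimeIntegral X μ c w)) := by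
  have := hX.isLevy.isProbabilityMeasure
  let F : ℝ → ℂ := fun s => complexMGF (X s.toNNReal) μ w
  obtain ⟨M, hM⟩ := hX.exists_norm_complexMGF_le hw hw
  have hmul : ∀ s t, 0 ≤ s → 0 ≤ t → F (s + t) = F s * F t := fun s t hs ht => by
    simp only [F]
    rw [Real.toNNReal_add hs ht, hX.complexMGF_add]
  have h0 : F 0 = 1 := by simp [F, complexMGF, hX.zero]
  have hF : Measurable F := (hX.measurable_complexMGF w).comp measurable_real_toNNReal
  have hlt : ∀ t : ℝ, t < 1 → t.toNNReal < 1 := fun t ht => by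
    rw [← Real.toNNReal_one]
    exact (Real.toNNReal_lt_toNNReal_iff one_pos).2 ht
  have hM' : ∀ t, 0 ≤ t → t < 1 → ‖F t‖ ≤ M := fun t _ ht => hM _ (hlt t ht) w ⟨le_rfl, le_rfl⟩
  have hrc : ∀ t, 0 ≤ t → t < 1 → ContinuousWithinAt F (Ici t) t := fun t _ ht =>
    (hX.rightCont_complexMGF hw (hlt t ht)).comp (f := Real.toNNReal)
      continuous_real_toNNReal.continuousWithinAt fun s hs => Real.toNNReal_le_toNNReal hs
  refine ⟨exists_integral_ne_zero h0 hF hM' hrc, fun c hc hc' hne t => ?_⟩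
  have h := eq_exp_of_mul hmul h0 hF hM' hrc hc hc' hne t.coe_nonneg
  simp only [F, Real.toNNReal_coe] at h
  exact h

/-- The Laplace exponent of the process on its strip: `E[e^{w X_t}] = e^{t κ(w)}`. -/
theorem IsRegularLevy.exists_laplaceExponent (hX : IsRegularLevy X μ) :
    ∃ κ : ℂ → ℂ,
      (∀ w : ℂ, w.re ∈ integrableExpSet (X 1) μ → ∀ t : ℝ≥0,
        complexMGF (X t) μ w = Complex.exp (t * κ w)) ∧
      ContinuousOn κ {w | w.re ∈ integrableExpSet (X 1) μ} ∧
      DifferentiableOn ℂ κ {w | w.re ∈ interior (integrableExpSet (X 1) μ)} := by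
  have hex : ∀ w : ℂ, ∃ κ : ℂ, w.re ∈ integrableExpSet (X 1) μ → ∀ t : ℝ≥0,
      complexMGF (X t) μ w = Complex.exp (t * κ) := by
    intro w
    by_cases hw : w.re ∈ integrableExpSet (X 1) μ
    · obtain ⟨⟨c, hc, hc', hne⟩, h⟩ := hX.complexMGF_eq_exp hw
      exact ⟨_, fun _ => h c hc hc' hne⟩
    · exact ⟨0, fun h => absurd h hw⟩
  choose κ hκ using hex
  have hcont : ContinuousOn κ {w | w.re ∈ integrableExpSet (X 1) μ} := by
    intro w hw
    obtain ⟨⟨c, hc, hc', hne⟩, -⟩ := hX.complexMGF_eq_exp hw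
    have hG := hX.continuousOn_mgfTimeIntegral hc (by linarith) w hw
    have hlt : c.toNNReal < 1 := by
      rw [← Real.toNNReal_one]
      exact (Real.toNNReal_lt_toNNReal_iff one_pos).2 (by linarith)
    -- The number `c` chosen at `w` still works at nearby points, and uniqueness of exponents
    -- identifies the chosen `κ z` with the quotient for that `c`. Hence `κ` is locally a quotient
    -- of continuous functions.
    have hform : ∀ z : ℂ, z.re ∈ integrableExpSet (X 1) μ → mgfTimeIntegral X μ c z ≠ 0 →
        κ z = (complexMGF (X c.toNNReal) μ z - 1) / mgfTimeIntegral X μ c z := fun z hz hne =>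
      exponent_unique fun t => by
        rw [← hκ z hz t, (hX.complexMGF_eq_exp hz).2 c hc hc' hne t]
    have hc1 : ContinuousWithinAt (fun z => (complexMGF (X c.toNNReal) μ z - 1) /
        mgfTimeIntegral X μ c z) {w | w.re ∈ integrableExpSet (X 1) μ} w :=
      ((hX.continuousOn_complexMGF hlt w hw).sub continuousWithinAt_const).div hG hne
    refine hc1.congr_of_eventuallyEq ?_ (hform w hw hne)
    filter_upwards [hG.eventually_ne hne, self_mem_nhdsWithin] with z hz hz'
    exact hform z hz' hz
  refine ⟨κ, hκ, hcont, fun w hw => DifferentiableAt.differentiableWithinAt ?_⟩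
  have hopen : IsOpen {w : ℂ | w.re ∈ interior (integrableExpSet (X 1) μ)} :=
    isOpen_interior.preimage Complex.continuous_re
  have hmem := hopen.mem_nhds hw
  have hκw : ContinuousAt κ w := hcont.continuousAt
    (Filter.mem_of_superset hmem fun z (hz : z.re ∈ _) => interior_subset (s := integrableExpSet
      (X 1) μ) hz)
  have hdiff : DifferentiableAt ℂ (complexMGF (X 1) μ) w :=
    differentiableOn_complexMGF.differentiableAt hmem
  have hone : ∀ z : ℂ, z.re ∈ interior (integrableExpSet (X 1) μ) →
      complexMGF (X 1) μ z = Complex.exp (κ z) := fun z hz => by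
    simpa using hκ z (interior_subset hz) 1
  -- Continuity keeps `κ z - κ w` within distance 1 of 0, where the principal logarithm inverts the
  -- exponential. Thus `κ` is locally a branch of the logarithm of the holomorphic moment generating
  -- function at time 1.
  have hlocal : κ =ᶠ[𝓝 w] fun z =>
      κ w + Complex.log (complexMGF (X 1) μ z * Complex.exp (-κ w)) := by
    filter_upwards [hmem, hκw.eventually (Metric.ball_mem_nhds (κ w) one_pos)] with z hz hz'
    have him := abs_le.1 ((Complex.abs_im_le_norm _).trans (mem_ball_iff_norm.1 hz').le)
    rw [hone z hz, ← Complex.exp_add, ← sub_eq_add_neg, Complex.log_exp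
      (by linarith [Real.pi_gt_three]) (by linarith [Real.pi_gt_three])]
    ring
  refine DifferentiableAt.congr_of_eventuallyEq ?_ hlocal
  refine (differentiableAt_const _).add (DifferentiableAt.clog (hdiff.mul_const _) ?_)
  rw [hone w hw, ← Complex.exp_add, add_neg_cancel, Complex.exp_zero]
  exact Complex.one_mem_slitPlane

variable {ζ : Ω → ℝ≥0∞} {q : ℝ}

lemma IsIndepExpTime.integral_alive (hX : IsLevyProcess X μ) (hζ : IsIndepExpTime X ζ q μ)
    (t : ℝ≥0) {f : ℝ → ℂ} (hf : Measurable f) :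
    ∫ ω, f (X t ω) ∂(aliveMeasure ζ μ t) = Real.exp (-(q * t)) * ∫ ω, f (X t ω) ∂μ := by
  rw [← integral_map (hX.measurable t).aemeasurable hf.aestronglyMeasurable,
    hζ.map_eval_alive hX t, integral_smul_measure,
    integral_map (hX.measurable t).aemeasurable hf.aestronglyMeasurable,
    ENNReal.toReal_ofReal (Real.exp_pos _).le, Complex.real_smul]

lemma IsIndepExpTime.lintegral_alive (hX : IsLevyProcess X μ) (hζ : IsIndepExpTime X ζ q μ)
    (t : ℝ≥0) {f : ℝ → ℝ≥0∞} (hf : Measurable f) :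
    ∫⁻ ω, f (X t ω) ∂(aliveMeasure ζ μ t) =
      ENNReal.ofReal (Real.exp (-(q * t))) * ∫⁻ ω, f (X t ω) ∂μ := by
  rw [← lintegral_map hf (hX.measurable t), hζ.map_eval_alive hX t, lintegral_smul_measure,
    lintegral_map hf (hX.measurable t), smul_eq_mul]

/-- Independent killing only multiplies the moment by the positive constant e^{-q}, so the strip is
that of the unkilled process. -/
lemma IsIndepExpTime.expMomentSet_eq (hX : IsLevyProcess X μ) (hζ : IsIndepExpTime X ζ q μ) :
    expMomentSet X ζ μ = integrableExpSet (X 1) μ := by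
  ext a
  have hg : Measurable fun y : ℝ => ENNReal.ofReal (Real.exp (a * y)) := by fun_prop
  rw [expMomentSet, ← lintegral_exp_lt_top_iff (hX.measurable 1),
    ← lintegral_exp_lt_top_iff (hX.measurable 1), hζ.lintegral_alive hX 1 hg,
    mul_comm]
  have h0 : ENNReal.ofReal (Real.exp (-(q * (1 : ℝ≥0)))) ≠ 0 := by
    rw [Ne, ENNReal.ofReal_eq_zero, not_le]
    exact Real.exp_pos _
  exact ⟨fun h => ENNReal.lt_top_of_mul_ne_top_left h.ne h0,
    fun h => ENNReal.mul_lt_top h ENNReal.ofReal_lt_top⟩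

/-- The exponent is `Ψ z = q - κ (i z)`: killing adds `q`, and `z ↦ iz` turns the horizontal strip
of `Ψ` into the vertical strip of `κ`. -/
theorem IsRegularLevy.exists_charExponent (hX : IsRegularLevy X μ)
    (hζ : IsIndepExpTime X ζ q μ) :
    ∃ Ψ : ℂ → ℂ, IsCharExponent X ζ μ Ψ ∧ ∀ w : ℂ, w.re ∈ expMomentSet X ζ μ → ∀ t : ℝ≥0,
      complexMGF (X t) (aliveMeasure ζ μ t) w =
        Complex.exp (-(t * Ψ (-(Complex.I * w)))) := by
  have := hX.isLevy.isProbabilityMeasure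
  obtain ⟨κ, hκ, hκc, hκd⟩ := hX.exists_laplaceExponent
  have hset := hζ.expMomentSet_eq hX.isLevy
  have hre : ∀ z : ℂ, (Complex.I * z).re = -z.im := fun z => by simp
  have hexp : ∀ w : ℂ, w.re ∈ expMomentSet X ζ μ → ∀ t : ℝ≥0,
      complexMGF (X t) (aliveMeasure ζ μ t) w = Complex.exp (-(t * (q - κ w))) := by
    intro w hw t
    have hg : Measurable fun y : ℝ => Complex.exp (w * y) := by fun_prop
    have h1 := hζ.integral_alive hX.isLevy t hg
    have h2 := hκ w (hset ▸ hw) t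
    rw [complexMGF] at h2
    rw [complexMGF, h1, h2, Complex.ofReal_exp, ← Complex.exp_add]
    congr 1
    push_cast
    ring
  refine ⟨fun z => q - κ (Complex.I * z), ⟨fun l t => ?_, ?_, ?_⟩, fun w hw t => ?_⟩
  · have hmem : (Complex.I * (l : ℂ)).re ∈ expMomentSet X ζ μ := by
      rw [hset]
      simp [integrableExpSet]
    exact hexp _ hmem t
  · refine continuousOn_const.sub (hκc.comp (by fun_prop) fun z hz => ?_)
    simp only [mem_ofPred_eq, hre]
    exact hset ▸ hz
  · refine (differentiableOn_const _).sub (hκd.comp (by fun_prop) fun z hz => ?_)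
    simp only [mem_ofPred_eq, hre]
    exact hset ▸ hz
  · rw [hexp w hw t]
    have : Complex.I * -(Complex.I * w) = w := by
      rw [mul_neg, ← mul_assoc, Complex.I_mul_I]
      ring
    simp only [this]

/-- The extension of the characteristic exponent to the strip is determined by its values on the
real line, even if the real line is part of the boundary of the strip. -/
theorem IsCharExponent.eq_of_re_pos {Ψ Ψ' : ℂ → ℂ} (h : IsCharExponent X ζ μ Ψ)
    (h' : IsCharExponent X ζ μ Ψ') (h0 : (0 : ℝ) ∈ expMomentSet X ζ μ) {w : ℂ} (hw : 0 < w.re)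
    (hmem : w.re ∈ expMomentSet X ζ μ) : Ψ (-(Complex.I * w)) = Ψ' (-(Complex.I * w)) := by
  have hconv : Convex ℝ (expMomentSet X ζ μ) := convex_integrableExpSet
  have hIcc : Icc 0 w.re ⊆ expMomentSet X ζ μ := hconv.ordConnected.out h0 hmem
  have hIoo : Ioo 0 w.re ⊆ interior (expMomentSet X ζ μ) :=
    interior_maximal (Ioo_subset_Icc_self.trans hIcc) isOpen_Ioo
  have him : ∀ z : ℂ, -(-(Complex.I * z)).im = z.re := fun z => by simp
  have hmapC : MapsTo (fun z : ℂ => -(Complex.I * z)) {z | z.re ∈ Icc 0 w.re}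
      {z | -z.im ∈ expMomentSet X ζ μ} := fun z hz => by
    simp only [mem_ofPred_eq, him]
    exact hIcc hz
  have hmapO : MapsTo (fun z : ℂ => -(Complex.I * z)) {z | z.re ∈ Ioo 0 w.re}
      {z | -z.im ∈ interior (expMomentSet X ζ μ)} := fun z hz => by
    simp only [mem_ofPred_eq, him]
    exact hIoo hz
  have key := eq_zero_of_strip (g := fun z => Ψ (-(Complex.I * z)) - Ψ' (-(Complex.I * z))) hw
    ((h.differentiableOn.comp (by fun_prop) hmapO).sub
      (h'.differentiableOn.comp (by fun_prop) hmapO))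
    ((h.continuousOn.comp (by fun_prop) hmapC).sub (h'.continuousOn.comp (by fun_prop) hmapC))
    (fun z hz => by
      have hz' : -(Complex.I * z) = ((z.im : ℝ) : ℂ) := by
        apply Complex.ext <;> simp [hz]
      have e : Ψ z.im = Ψ' z.im := by
        -- Agreement of the exponentials at all times `t`, not just at one, determines the exponent
        -- itself.
        have := exponent_unique (κ := -Ψ z.im) (κ' := -Ψ' z.im) fun t => by
          rw [mul_neg, mul_neg, ← h.charFun_eq, ← h'.charFun_eq]
        exact neg_injective this
      rw [hz', e, sub_self]) (z := w) ⟨hw.le, le_rfl⟩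
  exact sub_eq_zero.1 key

end ExpFunctional

/-! ### Finiteness of the moments -/

namespace ExpFunctional

/-- A weighted power bound for series of nonnegative terms. -/
lemma tsum_rpow_le {b : ℝ} (hb : 0 < b) {s : ℝ≥0∞} (hs0 : s ≠ 0) (hs : s < 1) (a : ℕ → ℝ≥0∞) :
    (∑' k, a k) ^ b ≤ ((1 - s ^ (1 / b))⁻¹) ^ b * ∑' k, (s⁻¹) ^ k * a k ^ b := by
  set T := ∑' k, (s⁻¹) ^ k * a k ^ b
  have hs_fin : s ≠ ∞ := (hs.trans ENNReal.one_lt_top).ne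
  -- Each single term is bounded through the weighted sum `T`, after which a geometric series
  -- remains. This treats exponents `b` below and above 1 alike.
  have h1 : ∀ k, a k ≤ (s ^ (1 / b)) ^ k * T ^ (1 / b) := by
    intro k
    have h2 : (s⁻¹) ^ k * a k ^ b ≤ T := ENNReal.le_tsum k
    have h3 : a k ^ b ≤ s ^ k * T := by
      calc a k ^ b = s ^ k * ((s⁻¹) ^ k * a k ^ b) := by
            rw [← mul_assoc, ← mul_pow, ENNReal.mul_inv_cancel hs0 hs_fin, one_pow, one_mul]
        _ ≤ s ^ k * T := by gcongr
    calc a k = (a k ^ b) ^ (1 / b) := by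
          rw [← ENNReal.rpow_mul, mul_one_div_cancel hb.ne', ENNReal.rpow_one]
      _ ≤ (s ^ k * T) ^ (1 / b) := ENNReal.rpow_le_rpow h3 (by positivity)
      _ = _ := by
          rw [ENNReal.mul_rpow_of_nonneg _ _ (by positivity), ← ENNReal.rpow_natCast,
            ← ENNReal.rpow_natCast, ← ENNReal.rpow_mul, ← ENNReal.rpow_mul, mul_comm (k : ℝ)]
  calc (∑' k, a k) ^ b ≤ (∑' k, (s ^ (1 / b)) ^ k * T ^ (1 / b)) ^ b :=
        ENNReal.rpow_le_rpow (ENNReal.tsum_le_tsum h1) hb.le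
    _ = _ := by
        rw [ENNReal.tsum_mul_right, ENNReal.tsum_geometric,
          ENNReal.mul_rpow_of_nonneg _ _ hb.le, ← ENNReal.rpow_mul, one_div_mul_cancel hb.ne',
          ENNReal.rpow_one]

variable {Ω : Type*} [MeasurableSpace Ω] {μ : Measure Ω} {X : ℝ≥0 → Ω → ℝ} {ζ : Ω → ℝ≥0∞} {q : ℝ}

lemma IsRegularLevy.measurable_path (hX : IsRegularLevy X μ) : Measurable fun ω t => X t ω :=
  measurable_pi_lambda _ hX.isLevy.measurable

lemma IsRegularLevy.expFunctional_eq (hX : IsRegularLevy X μ) (ω : Ω) :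
    expFunctional X ζ ω = expIntM ((fun t => X t ω), ζ ω) :=
  ((hX.rightCont ω).expIntM_eq (ζ ω)).symm

lemma IsRegularLevy.measurable_expFunctional (hX : IsRegularLevy X μ) (hζ : Measurable ζ) :
    Measurable (expFunctional X ζ) := by
  rw [show expFunctional X ζ = fun ω => expIntM ((fun t => X t ω), ζ ω) from
    funext hX.expFunctional_eq]
  exact measurable_expIntM.comp (hX.measurable_path.prodMk hζ)

/-- The Markov property for nonnegative functionals. -/
lemma IsRegularLevy.lintegral_restart (hX : IsRegularLevy X μ) (hζ : IsIndepExpTime X ζ q μ)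
    (s : ℝ≥0) {f : ℝ → ℝ≥0∞} (hf : Measurable f) {G : (ℝ≥0 → ℝ) × ℝ≥0∞ → ℝ≥0∞}
    (hG : Measurable G) :
    ∫⁻ ω, f (X s ω) * G (shift (fun t => X t ω) s, ζ ω - s) ∂(aliveMeasure ζ μ s) =
      (∫⁻ ω, f (X s ω) ∂(aliveMeasure ζ μ s)) * ∫⁻ ω, G ((fun t => X t ω), ζ ω) ∂μ := by
  have := hX.isLevy.isProbabilityMeasure
  have hpm := hX.measurable_path.prodMk hζ.measurable
  have hpr : Measurable fun ω => (X s ω, (shift (fun t => X t ω) s, ζ ω - s)) :=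
    (hX.isLevy.measurable s).prodMk ((hX.isLevy.measurable_shift s).prodMk
      (hζ.measurable.sub measurable_const))
  have hfin : IsFiniteMeasure (aliveMeasure ζ μ s) := by unfold aliveMeasure; infer_instance
  have h1 : ∫⁻ ω, f (X s ω) * G (shift (fun t => X t ω) s, ζ ω - s) ∂(aliveMeasure ζ μ s) =
      ∫⁻ p, f p.1 * G p.2 ∂((aliveMeasure ζ μ s).map
        fun ω => (X s ω, (shift (fun t => X t ω) s, ζ ω - s))) :=
    (lintegral_map ((hf.comp measurable_fst).mul (hG.comp measurable_snd)) hpr).symm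
  rw [h1, hζ.map_restart hX.isLevy hX.zero,
    lintegral_prod_mul hf.aemeasurable hG.aemeasurable, lintegral_map hf (hX.isLevy.measurable s),
    lintegral_map hG hpm]

/-- The Markov property for complex functionals. -/
lemma IsRegularLevy.integral_restart (hX : IsRegularLevy X μ) (hζ : IsIndepExpTime X ζ q μ)
    (s : ℝ≥0) {f : ℝ → ℂ} (hf : Measurable f) {G : (ℝ≥0 → ℝ) × ℝ≥0∞ → ℂ} (hG : Measurable G) :
    ∫ ω, f (X s ω) * G (shift (fun t => X t ω) s, ζ ω - s) ∂(aliveMeasure ζ μ s) =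
      (∫ ω, f (X s ω) ∂(aliveMeasure ζ μ s)) * ∫ ω, G ((fun t => X t ω), ζ ω) ∂μ := by
  have := hX.isLevy.isProbabilityMeasure
  have hpm := hX.measurable_path.prodMk hζ.measurable
  have hpr : Measurable fun ω => (X s ω, (shift (fun t => X t ω) s, ζ ω - s)) :=
    (hX.isLevy.measurable s).prodMk ((hX.isLevy.measurable_shift s).prodMk
      (hζ.measurable.sub measurable_const))
  have hfin : IsFiniteMeasure (aliveMeasure ζ μ s) := by unfold aliveMeasure; infer_instance
  have hfG : Measurable fun p : ℝ × ((ℝ≥0 → ℝ) × ℝ≥0∞) => f p.1 * G p.2 := by fun_prop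
  have h1 : ∫ ω, f (X s ω) * G (shift (fun t => X t ω) s, ζ ω - s) ∂(aliveMeasure ζ μ s) =
      ∫ p, f p.1 * G p.2 ∂((aliveMeasure ζ μ s).map
        fun ω => (X s ω, (shift (fun t => X t ω) s, ζ ω - s))) :=
    (integral_map hpr.aemeasurable hfG.aestronglyMeasurable).symm
  rw [h1, hζ.map_restart hX.isLevy hX.zero, integral_prod_mul,
    integral_map (hX.isLevy.measurable s).aemeasurable hf.aestronglyMeasurable,
    integral_map hpm.aemeasurable hG.aestronglyMeasurable]

/-- The real exponential moment `E[e^{b ξ_t}, t < ζ]`. -/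
noncomputable def aliveMoment (X : ℝ≥0 → Ω → ℝ) (ζ : Ω → ℝ≥0∞) (μ : Measure Ω) (b : ℝ)
    (t : ℝ≥0) : ℝ≥0∞ := ∫⁻ ω, ENNReal.ofReal (Real.exp (b * X t ω)) ∂(aliveMeasure ζ μ t)

lemma IsRegularLevy.aliveMoment_nat (hX : IsRegularLevy X μ) (hζ : IsIndepExpTime X ζ q μ)
    (b : ℝ) (k : ℕ) : aliveMoment X ζ μ b k = aliveMoment X ζ μ b 1 ^ k := by
  have := hX.isLevy.isProbabilityMeasure
  have hg : Measurable fun y : ℝ => ENNReal.ofReal (Real.exp (b * y)) := by fun_prop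
  have h : ∀ t : ℝ≥0, aliveMoment X ζ μ b t = ENNReal.ofReal (Real.exp (-(q * t))) *
      ∫⁻ ω, ENNReal.ofReal (Real.exp (b * X t ω)) ∂μ := fun t => hζ.lintegral_alive hX.isLevy t hg
  induction k with
  | zero => simp [h, hX.zero]
  | succ k ih =>
    rw [pow_succ, ← ih, Nat.cast_succ, h, h, h, hX.lintegral_exp_add]
    rw [show -(q * ((k : ℝ≥0) + 1 : ℝ≥0)) = -(q * (k : ℝ≥0)) + -(q * (1 : ℝ≥0)) by push_cast; ring,
      Real.exp_add, ENNReal.ofReal_mul (Real.exp_pos _).le]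
    ring

lemma mgf_lt_one_iff (hX : Measurable (X 1)) {b : ℝ} (hb : b ∈ expMomentSet X ζ μ) :
    mgf (X 1) (aliveMeasure ζ μ 1) b < 1 ↔ aliveMoment X ζ μ b 1 < 1 := by
  have h1 : mgf (X 1) (aliveMeasure ζ μ 1) b = (aliveMoment X ζ μ b 1).toReal := by
    rw [mgf, aliveMoment, integral_eq_lintegral_of_nonneg_ae
      (Eventually.of_forall fun ω => (Real.exp_pos _).le)]
    have : Measurable fun ω => Real.exp (b * X 1 ω) := by fun_prop
    exact this.aestronglyMeasurable
  have h2 : aliveMoment X ζ μ b 1 ≠ ∞ := ((lintegral_exp_lt_top_iff hX b).2 hb).ne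
  rw [h1, ← ENNReal.toReal_one, ENNReal.toReal_lt_toReal h2 ENNReal.one_ne_top]

lemma IsIndepExpTime.ae_pos [IsProbabilityMeasure μ] (hζ : IsIndepExpTime X ζ q μ) :
    ∀ᵐ ω ∂μ, 0 < ζ ω := by
  have h := hζ.tail 0
  simp only [ENNReal.coe_zero, NNReal.coe_zero, mul_zero, neg_zero, Real.exp_zero,
    ENNReal.ofReal_one] at h
  exact (prob_compl_eq_zero_iff (measurableSet_lt measurable_const hζ.measurable)).2 h

lemma IsRegularLevy.ae_expFunctional_pos (hX : IsRegularLevy X μ) (hζ : IsIndepExpTime X ζ q μ) :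
    ∀ᵐ ω ∂μ, 0 < expFunctional X ζ ω := by
  have := hX.isLevy.isProbabilityMeasure
  filter_upwards [hζ.ae_pos] with ω hω
  exact (hX.rightCont ω).expInt_pos hω

/-- A finite moment already makes the exponential functional finite; no assumption on the killing
rate or on the drift of the process is needed for this. -/
lemma IsRegularLevy.ae_expFunctional_lt_top (hX : IsRegularLevy X μ)
    (hζ : IsIndepExpTime X ζ q μ) {b : ℝ} (hb : 0 < b) (h : absMoment X ζ μ b < ∞) :
    ∀ᵐ ω ∂μ, expFunctional X ζ ω < ∞ := by
  have hm := (hX.measurable_expFunctional hζ.measurable).pow_const b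
  filter_upwards [ae_lt_top hm h.ne] with ω hω
  exact (ENNReal.rpow_lt_top_iff_of_pos hb).1 hω

lemma IsRegularLevy.lintegral_restart_moment (hX : IsRegularLevy X μ)
    (hζ : IsIndepExpTime X ζ q μ) (a b : ℝ) (s : ℝ≥0) :
    ∫⁻ ω, ENNReal.ofReal (Real.exp (a * X s ω)) *
      expInt (shift (fun t => X t ω) s) (ζ ω - s) ^ b ∂(aliveMeasure ζ μ s) =
      aliveMoment X ζ μ a s * absMoment X ζ μ b := by
  have h := hX.lintegral_restart hζ s
    (f := fun y => ENNReal.ofReal (Real.exp (a * y))) (by fun_prop)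
    (G := fun p => expIntM p ^ b) (measurable_expIntM.pow_const b)
  simp only [((hX.rightCont _).shifted s).expIntM_eq, (hX.rightCont _).expIntM_eq] at h
  exact h

/-- A finite moment forces the exponential moment to be smaller than one. -/
theorem IsRegularLevy.aliveMoment_lt_one (hX : IsRegularLevy X μ) (hζ : IsIndepExpTime X ζ q μ)
    {b : ℝ} (hb : 0 < b) (h : absMoment X ζ μ b < ∞) : aliveMoment X ζ μ b 1 < 1 := by
  have := hX.isLevy.isProbabilityMeasure
  have hrest := hX.lintegral_restart_moment hζ b b 1
  rw [aliveMeasure, ← lintegral_indicator (measurableSet_alive hζ 1)] at hrest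
  set u : Ω → ℝ≥0∞ := {ω | ((1 : ℝ≥0) : ℝ≥0∞) < ζ ω}.indicator fun ω =>
    ENNReal.ofReal (Real.exp (b * X 1 ω)) *
      expInt (shift (fun t => X t ω) 1) (ζ ω - (1 : ℝ≥0)) ^ b with hu
  -- Strictness comes from the positive integral over `[0, 1]` on survival past time 1, and from
  -- positivity of the functional itself otherwise, where `u` is zero.
  have hlt : ∀ᵐ ω ∂μ, u ω < expFunctional X ζ ω ^ b := by
    filter_upwards [hX.ae_expFunctional_pos hζ, hX.ae_expFunctional_lt_top hζ hb h] with ω h1 h2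
    by_cases hω : ((1 : ℝ≥0) : ℝ≥0∞) < ζ ω
    · rw [hu, indicator_of_mem (by exact hω)]
      have hsplit : expFunctional X ζ ω = _ := expInt_eq_add (fun t => X t ω) hω.le
      have hpos : 0 < expInt (fun t => X t ω) (1 : ℝ≥0) := (hX.rightCont ω).expInt_pos (by simp)
      have e : ENNReal.ofReal (Real.exp (b * X 1 ω)) *
          expInt (shift (fun t => X t ω) 1) (ζ ω - (1 : ℝ≥0)) ^ b =
          (ENNReal.ofReal (Real.exp (X 1 ω)) *
            expInt (shift (fun t => X t ω) 1) (ζ ω - (1 : ℝ≥0))) ^ b := by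
        rw [ENNReal.mul_rpow_of_nonneg _ _ hb.le, ENNReal.ofReal_rpow_of_pos (Real.exp_pos _),
          ← Real.exp_mul, mul_comm b]
      rw [e]
      refine ENNReal.rpow_lt_rpow ?_ hb
      rw [hsplit] at h2 ⊢
      rw [add_comm]
      exact ENNReal.lt_add_right (ENNReal.add_lt_top.1 h2).2.ne hpos.ne'
    · rw [hu, indicator_of_notMem (by exact hω)]
      exact ENNReal.rpow_pos_of_nonneg h1 hb.le
  have hle : ∫⁻ ω, u ω ∂μ ≤ absMoment X ζ μ b := lintegral_mono_ae (hlt.mono fun ω h => h.le)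
  have hstrict := lintegral_strict_mono (IsProbabilityMeasure.ne_zero μ)
    ((hX.measurable_expFunctional hζ.measurable).pow_const b).aemeasurable
    (hle.trans_lt h).ne hlt
  rw [hrest] at hstrict
  by_contra hcon
  rw [not_lt] at hcon
  have : 1 * absMoment X ζ μ b ≤ aliveMoment X ζ μ b 1 * absMoment X ζ μ b := by gcongr
  rw [one_mul] at this
  exact absurd hstrict (not_lt.2 this)

/-- Over a unit interval an integral is at most any upper bound of its integrand, and `gridMax X b ω
^ (1 / b)` bounds e^{X_t} for `t < 1`. -/
lemma IsRegularLevy.expInt_one_rpow_le (hX : IsRegularLevy X μ) {b : ℝ} (hb : 0 < b) (ω : Ω) :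
    expInt (fun t => X t ω) 1 ^ b ≤ gridMax X b ω := by
  have h1 : expInt (fun t => X t ω) 1 ≤ gridMax X b ω ^ (1 / b) := by
    calc expInt (fun t => X t ω) 1
        ≤ ∫⁻ _ in {s : ℝ | 0 ≤ s ∧ ENNReal.ofReal s < 1}, gridMax X b ω ^ (1 / b) := by
          refine setLIntegral_mono' (measurableSet_alive_section 1) fun s hs => ?_
          have hs1 : s.toNNReal < 1 := by
            have := hs.2
            rw [ENNReal.ofReal] at this
            exact_mod_cast this
          have h2 := hX.exp_le_gridMax b hs1 ω
          calc ENNReal.ofReal (Real.exp (X s.toNNReal ω))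
              = ENNReal.ofReal (Real.exp (b * X s.toNNReal ω)) ^ (1 / b) := by
                rw [ENNReal.ofReal_rpow_of_pos (Real.exp_pos _), ← Real.exp_mul]
                congr 2
                field_simp
            _ ≤ _ := ENNReal.rpow_le_rpow h2 (by positivity)
      _ ≤ gridMax X b ω ^ (1 / b) * volume (Ico (0 : ℝ) 1) := by
          rw [setLIntegral_const]
          gcongr
          rintro s ⟨h1, h2⟩
          exact ⟨h1, by simpa using h2⟩
      _ = _ := by simp
  calc expInt (fun t => X t ω) 1 ^ b ≤ (gridMax X b ω ^ (1 / b)) ^ b :=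
        ENNReal.rpow_le_rpow h1 hb.le
    _ = _ := by rw [← ENNReal.rpow_mul, one_div_mul_cancel hb.ne', ENNReal.rpow_one]

/-- Each unit block that starts before `z` is extended to full length, ignoring killing inside it.
The lifetime then enters only through the event `k < z`, which suits the Markov property at time
`k`. -/
lemma expInt_le_tsum (x : ℝ≥0 → ℝ) (z : ℝ≥0∞) :
    expInt x z ≤ ∑' k : ℕ, {z : ℝ≥0∞ | ((k : ℝ≥0) : ℝ≥0∞) < z}.indicator
      (fun _ => ENNReal.ofReal (Real.exp (x k)) * expInt (shift x k) 1) z := by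
  set S : ℕ → Set ℝ := fun k => {s | ((k : ℝ≥0) : ℝ) ≤ s ∧ ENNReal.ofReal s < min z (k + 1)}
  have hcover : {s : ℝ | 0 ≤ s ∧ ENNReal.ofReal s < z} ⊆ ⋃ k, S k := by
    rintro s ⟨h0, hz⟩
    refine mem_iUnion.2 ⟨⌊s⌋₊, by simpa using Nat.floor_le h0, lt_min hz ?_⟩
    have := Nat.lt_floor_add_one s
    calc ENNReal.ofReal s < ENNReal.ofReal (⌊s⌋₊ + 1) :=
          (ENNReal.ofReal_lt_ofReal_iff_of_nonneg h0).2 this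
      _ = _ := by rw [ENNReal.ofReal_add (by positivity) one_pos.le]; simp
  calc expInt x z ≤ ∫⁻ s in ⋃ k, S k, ENNReal.ofReal (Real.exp (x s.toNNReal)) :=
        lintegral_mono_set hcover
    _ ≤ ∑' k, ∫⁻ s in S k, ENNReal.ofReal (Real.exp (x s.toNNReal)) := lintegral_iUnion_le _ _
    _ ≤ _ := by
        refine ENNReal.tsum_le_tsum fun k => ?_
        by_cases hk : ((k : ℝ≥0) : ℝ≥0∞) < z
        · rw [indicator_of_mem (by exact hk)]
          have h := lintegral_tail_eq x (k + 1 : ℝ≥0∞) k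
          have e : ((k : ℝ≥0∞) + 1) - ((k : ℝ≥0) : ℝ≥0∞) = 1 := by
            rw [ENNReal.coe_natCast]
            exact ENNReal.add_sub_cancel_left (by simp)
          rw [e] at h
          rw [← h]
          exact lintegral_mono_set fun s hs => ⟨hs.1, hs.2.trans_le (min_le_right _ _)⟩
        · have : S k = ∅ := by
            ext s
            simp only [S, mem_ofPred_eq, mem_empty_iff_false, iff_false, not_and, not_lt]
            intro hs
            refine (min_le_left _ _).trans ((not_lt.1 hk).trans ?_)
            rw [← ENNReal.ofReal_coe_nnreal]
            exact ENNReal.ofReal_le_ofReal hs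
          rw [this]
          simp

/-- An exponential moment smaller than one gives a finite moment. -/
theorem IsRegularLevy.absMoment_lt_top (hX : IsRegularLevy X μ) (hζ : IsIndepExpTime X ζ q μ)
    {b : ℝ} (hb : 0 < b) (hmem : b ∈ expMomentSet X ζ μ) (h : aliveMoment X ζ μ b 1 < 1) :
    absMoment X ζ μ b < ∞ := by
  have := hX.isLevy.isProbabilityMeasure
  set m := aliveMoment X ζ μ b 1
  -- Room on both sides: `s < 1` sums the series in `s ^ (1 / b)`, and `m < s` sums the series in
  -- `s⁻¹ * m`.
  obtain ⟨s, hms, hs1⟩ := exists_between h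
  have hs0 : s ≠ 0 := (zero_le.trans_lt hms).ne'
  have hs_fin : s ≠ ∞ := (hs1.trans ENNReal.one_lt_top).ne
  have hD : ∫⁻ ω, gridMax X b ω ∂μ < ∞ := hX.lintegral_gridMax_lt_top
    ((lintegral_exp_lt_top_iff (hX.isLevy.measurable 1) b).2
      (hζ.expMomentSet_eq hX.isLevy ▸ hmem))
  set D := ∫⁻ ω, expInt (fun t => X t ω) 1 ^ b ∂μ with hDdef
  have hDtop : D < ∞ := (lintegral_mono fun ω => hX.expInt_one_rpow_le hb ω).trans_lt hD
  let a : ℕ → Ω → ℝ≥0∞ := fun k => {ω | ((k : ℝ≥0) : ℝ≥0∞) < ζ ω}.indicator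
      (fun ω => ENNReal.ofReal (Real.exp (X k ω)) * expInt (shift (fun t => X t ω) k) 1)
  have hapow : ∀ k ω, a k ω ^ b = {ω | ((k : ℝ≥0) : ℝ≥0∞) < ζ ω}.indicator
      (fun ω => ENNReal.ofReal (Real.exp (b * X k ω)) *
        expIntM (shift (fun t => X t ω) k, 1) ^ b) ω := by
    intro k ω
    simp only [a]
    by_cases hω : ((k : ℝ≥0) : ℝ≥0∞) < ζ ω
    · rw [indicator_of_mem (by exact hω), indicator_of_mem (by exact hω),
        ENNReal.mul_rpow_of_nonneg _ _ hb.le, ENNReal.ofReal_rpow_of_pos (Real.exp_pos _),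
        ← Real.exp_mul, mul_comm b, ((hX.rightCont ω).shifted k).expIntM_eq]
    · rw [indicator_of_notMem (by exact hω), indicator_of_notMem (by exact hω),
        ENNReal.zero_rpow_of_pos hb]
  have hGm : Measurable fun p : (ℝ≥0 → ℝ) × ℝ≥0∞ => expIntM (p.1, 1) ^ b :=
    (measurable_expIntM.comp (measurable_fst.prodMk measurable_const)).pow_const b
  have ham : ∀ k, Measurable fun ω => a k ω ^ b := by
    intro k
    simp only [hapow]
    refine Measurable.indicator ?_ (measurableSet_alive hζ k)
    have h1 := hX.isLevy.measurable k
    have h2 := measurable_expIntM.comp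
      ((hX.isLevy.measurable_shift k).prodMk (measurable_const (a := (1 : ℝ≥0∞))))
    exact Measurable.mul (by fun_prop) (h2.pow_const b)
  have hint : ∀ k : ℕ, ∫⁻ ω, a k ω ^ b ∂μ = m ^ k * D := by
    intro k
    simp only [hapow]
    rw [lintegral_indicator (measurableSet_alive hζ k)]
    have h1 := hX.lintegral_restart hζ k
      (f := fun y => ENNReal.ofReal (Real.exp (b * y))) (by fun_prop) hGm
    refine h1.trans ?_
    rw [← hX.aliveMoment_nat hζ, aliveMoment]
    simp only [(hX.rightCont _).expIntM_eq]
    rfl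
  calc absMoment X ζ μ b ≤ ∫⁻ ω, ((1 - s ^ (1 / b))⁻¹) ^ b * ∑' k, (s⁻¹) ^ k * a k ω ^ b ∂μ := by
        refine lintegral_mono fun ω => ?_
        refine le_trans (ENNReal.rpow_le_rpow ?_ hb.le)
          (tsum_rpow_le hb hs0 hs1 fun k => a k ω)
        exact expInt_le_tsum (fun t => X t ω) (ζ ω)
    _ = ((1 - s ^ (1 / b))⁻¹) ^ b * ∑' k, (s⁻¹ * m) ^ k * D := by
        rw [lintegral_const_mul, lintegral_tsum]
        · congr 1
          refine tsum_congr fun k => ?_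
          rw [lintegral_const_mul _ (ham k), hint, mul_pow, mul_assoc]
        · exact fun k => ((ham k).const_mul _).aemeasurable
        · exact Measurable.tsum fun k => (ham k).const_mul _
    _ < ∞ := by
        rw [ENNReal.tsum_mul_right, ENNReal.tsum_geometric]
        have hr : s ^ (1 / b) < 1 := ENNReal.rpow_lt_one hs1 (by positivity)
        have hρ : s⁻¹ * m < 1 := by
          rw [← ENNReal.div_eq_inv_mul]
          exact ENNReal.div_lt_of_lt_mul (by rwa [one_mul])
        refine ENNReal.mul_lt_top (ENNReal.rpow_lt_top_of_nonneg hb.le ?_) (ENNReal.mul_lt_top ?_ hDtop)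
        · exact (ENNReal.inv_lt_top.2 (tsub_pos_of_lt hr)).ne
        · exact ENNReal.inv_lt_top.2 (tsub_pos_of_lt hρ)

end ExpFunctional

/-! ### The probability integral transform -/

namespace ExpFunctional

section ProbabilityTransform

variable {ν : Measure ℝ} [IsFiniteMeasure ν]

/-- By inner regularity a compact subset of `S` may replace `S`; it has a least element, which lies
in `S`, and is contained in the half-line starting there. -/
lemma measure_le_of_forall_Ici {S : Set ℝ} (hS : MeasurableSet S) {a : ℝ≥0∞}
    (hup : ∀ s ∈ S, ν (Ici s) ≤ a) : ν S ≤ a := by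
  by_contra! hlt
  obtain ⟨K, hKS, hK, hlt'⟩ := hS.exists_lt_isCompact_of_ne_top (measure_ne_top ν S) hlt
  rcases K.eq_empty_or_nonempty with rfl | hne
  · simp at hlt'
  · obtain ⟨k, hk⟩ := hK.exists_isLeast hne
    exact absurd ((measure_mono fun s hs => hk.2 hs).trans (hup k (hKS hk.1))) (not_le.2 hlt')

lemma measure_le_of_forall_Iic {S : Set ℝ} (hS : MeasurableSet S) {a : ℝ≥0∞}
    (hlow : ∀ s ∈ S, ν (Iic s) ≤ a) : ν S ≤ a := by
  by_contra! hlt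
  obtain ⟨K, hKS, hK, hlt'⟩ := hS.exists_lt_isCompact_of_ne_top (measure_ne_top ν S) hlt
  rcases K.eq_empty_or_nonempty with rfl | hne
  · simp at hlt'
  · obtain ⟨k, hk⟩ := hK.exists_isGreatest hne
    exact absurd ((measure_mono fun s hs => hk.2 hs).trans (hlow k (hKS hk.1))) (not_le.2 hlt')

lemma antitone_measureReal_Ici : Antitone fun s => ν.real (Ici s) := fun _ _ h =>
  measureReal_mono (Ici_subset_Ici.2 h)

/-- The probability integral transform: the tail function of a finite measure without atoms
transports it to Lebesgue measure. -/
theorem map_tail_eq [NullSingletonClass ν] :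
    ν.map (fun s => ν.real (Ici s)) = volume.restrict (Ioc 0 (ν.real univ)) := by
  have hm : Measurable fun s => ν.real (Ici s) := antitone_measureReal_Ici.measurable
  refine Measure.ext_of_Iic _ _ fun a => ?_
  rw [Measure.map_apply hm measurableSet_Iic, Measure.restrict_apply measurableSet_Iic]
  have hS : MeasurableSet ((fun s => ν.real (Ici s)) ⁻¹' Iic a) := hm measurableSet_Iic
  set S := (fun s => ν.real (Ici s)) ⁻¹' Iic a with hSdef
  set I := ν.real univ with hI
  have hIle : ∀ s, ν.real (Ici s) ≤ I := fun s => measureReal_mono (subset_univ _)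
  have hvol : volume (Iic a ∩ Ioc 0 I) = ENNReal.ofReal (min a I) := by
    rw [show Iic a ∩ Ioc 0 I = Ioc 0 (min a I) by
      ext x; simp only [mem_inter_iff, mem_Iic, mem_Ioc, le_min_iff]; tauto, Real.volume_Ioc,
      sub_zero]
  rw [hvol]
  rcases lt_or_ge a 0 with ha | ha
  · have : S = ∅ := by
      ext s
      simp only [hSdef, mem_preimage, mem_Iic, mem_empty_iff_false, iff_false, not_le]
      exact ha.trans_le measureReal_nonneg
    rw [this, measure_empty, ENNReal.ofReal_of_nonpos ((min_le_left _ _).trans ha.le)]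
  rcases le_or_gt I a with haI | haI
  · have : S = univ := by
      ext s
      simp only [hSdef, mem_preimage, mem_Iic, mem_univ, iff_true]
      exact (hIle s).trans haI
    rw [this, min_eq_right haI, hI, ofReal_measureReal]
  · rw [min_eq_left haI.le]
    -- The sublevel set is bounded by upper half-lines and its complement by lower ones. Absence of
    -- atoms makes the two bounds add up to the total mass, so both are equalities.
    refine le_antisymm (measure_le_of_forall_Ici hS fun s hs => ?_) ?_
    · rw [← ofReal_measureReal]
      exact ENNReal.ofReal_le_ofReal hs
    · have hc : ν Sᶜ ≤ ENNReal.ofReal (I - a) := by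
        refine measure_le_of_forall_Iic hS.compl fun s hs => ?_
        have hs' : a < ν.real (Ici s) := not_le.1 hs
        rw [← ofReal_measureReal]
        refine ENNReal.ofReal_le_ofReal ?_
        have h1 : ν.real (Iic s) = ν.real (Iio s) := measureReal_congr Iio_ae_eq_Iic.symm
        have h2 : ν.real (Iio s) = I - ν.real (Ici s) := by
          rw [← compl_Ici, measureReal_compl measurableSet_Ici]
        linarith
      have h1 : ν.real Sᶜ ≤ I - a :=
        ENNReal.toReal_le_of_le_ofReal (by linarith) hc
      rw [measureReal_compl hS] at h1
      rw [← ofReal_measureReal]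
      exact ENNReal.ofReal_le_ofReal (by linarith)

/-- Transporting `ν` to Lebesgue measure reduces this to the integral of a^{β-1} over (0, ν(ℝ)]. It
replaces the chain rule for powers of the tail and needs no differentiability of it. -/
lemma integral_tail_cpow [NullSingletonClass ν] {β : ℂ} (hβ : 0 < β.re) :
    ∫ s, ((ν.real (Ici s) : ℂ)) ^ (β - 1) ∂ν = (ν.real univ : ℂ) ^ β / β := by
  have hm : Measurable fun s => ν.real (Ici s) := antitone_measureReal_Ici.measurable
  have hg : Measurable fun a : ℝ => (a : ℂ) ^ (β - 1) := by fun_prop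
  have h1 : ∫ s, ((ν.real (Ici s) : ℂ)) ^ (β - 1) ∂ν =
      ∫ a, (a : ℂ) ^ (β - 1) ∂(ν.map fun s => ν.real (Ici s)) :=
    (integral_map hm.aemeasurable hg.aestronglyMeasurable).symm
  have hβ0 : β ≠ 0 := fun h => by simp [h] at hβ
  rw [h1, map_tail_eq, ← intervalIntegral.integral_of_le measureReal_nonneg,
    integral_cpow (Or.inl (by simpa using hβ)), sub_add_cancel, Complex.ofReal_zero,
    Complex.zero_cpow hβ0, sub_zero]

lemma lintegral_tail_rpow [NullSingletonClass ν] {b : ℝ} (hb : 0 < b) :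
    ENNReal.ofReal b * ∫⁻ s, ENNReal.ofReal (ν.real (Ici s) ^ (b - 1)) ∂ν =
      ENNReal.ofReal (ν.real univ ^ b) := by
  have hm : Measurable fun s => ν.real (Ici s) := antitone_measureReal_Ici.measurable
  have hg : Measurable fun a : ℝ => ENNReal.ofReal (a ^ (b - 1)) := by fun_prop
  have h1 : ∫⁻ s, ENNReal.ofReal (ν.real (Ici s) ^ (b - 1)) ∂ν =
      ∫⁻ a, ENNReal.ofReal (a ^ (b - 1)) ∂(ν.map fun s => ν.real (Ici s)) :=
    (lintegral_map hg hm).symm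
  have hI : 0 ≤ ν.real univ := measureReal_nonneg
  have hint : IntervalIntegrable (fun a : ℝ => a ^ (b - 1)) volume 0 (ν.real univ) :=
    intervalIntegral.intervalIntegrable_rpow' (by linarith)
  rw [h1, map_tail_eq, ← ofReal_integral_eq_lintegral_ofReal
      ((intervalIntegrable_iff_integrableOn_Ioc_of_le hI).1 hint)
      ((ae_restrict_mem measurableSet_Ioc).mono fun a ha => Real.rpow_nonneg ha.1.le _),
    ← intervalIntegral.integral_of_le hI, integral_rpow (Or.inl (by linarith)), sub_add_cancel,
    Real.zero_rpow hb.ne', sub_zero, ← ENNReal.ofReal_mul hb.le, mul_div_cancel₀ _ hb.ne']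

end ProbabilityTransform

/-! ### Powers of the tail integral along a path -/

section Pathwise

variable {x : ℝ≥0 → ℝ} {z : ℝ≥0∞}

/-- The measure `e^{x_s} ds` on `[0, z)`. -/
noncomputable def expMeasure (x : ℝ≥0 → ℝ) (z : ℝ≥0∞) : Measure ℝ :=
  (volume.restrict {s : ℝ | 0 ≤ s ∧ ENNReal.ofReal s < z}).withDensity
    fun s => ENNReal.ofReal (Real.exp (x s.toNNReal))

lemma expMeasure_univ : expMeasure x z univ = expInt x z := by
  rw [expMeasure, withDensity_apply _ MeasurableSet.univ, Measure.restrict_univ, expInt]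

lemma expMeasure_Ici {s : ℝ} (hs : 0 ≤ s) :
    expMeasure x z (Ici s) = ENNReal.ofReal (Real.exp (x s.toNNReal)) *
      expInt (shift x s.toNNReal) (z - s.toNNReal) := by
  rw [expMeasure, withDensity_apply _ measurableSet_Ici, Measure.restrict_restrict measurableSet_Ici,
    ← lintegral_tail_eq]
  congr 2
  ext r
  simp only [mem_inter_iff, mem_Ici, mem_ofPred_eq, Real.coe_toNNReal s hs]
  exact ⟨fun h => ⟨h.1, h.2.2⟩, fun h => ⟨h.1, hs.trans h.1, h.2⟩⟩

instance : NullSingletonClass (expMeasure x z) := by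
  unfold expMeasure
  infer_instance

lemma isFiniteMeasure_expMeasure (h : expInt x z < ∞) : IsFiniteMeasure (expMeasure x z) :=
  ⟨by rwa [expMeasure_univ]⟩

lemma expMeasure_real_Ici {s : ℝ} (hs : 0 ≤ s) :
    (expMeasure x z).real (Ici s) = Real.exp (x s.toNNReal) *
      (expInt (shift x s.toNNReal) (z - s.toNNReal)).toReal := by
  rw [measureReal_def, expMeasure_Ici hs, ENNReal.toReal_mul,
    ENNReal.toReal_ofReal (Real.exp_pos _).le]

/-- Differentiating a complex power of the tail integral. -/
theorem IsRightCont.expInt_cpow (hx : IsRightCont x) (hfin : expInt x z < ∞) {β : ℂ}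
    (hβ : 0 < β.re) :
    ∫ s in {s : ℝ | 0 ≤ s ∧ ENNReal.ofReal s < z}, Complex.exp (β * x s.toNNReal) *
      ((expInt (shift x s.toNNReal) (z - s.toNNReal)).toReal : ℂ) ^ (β - 1) =
      ((expInt x z).toReal : ℂ) ^ β / β := by
  have := isFiniteMeasure_expMeasure hfin
  have h := integral_tail_cpow (ν := expMeasure x z) hβ
  rw [measureReal_def, expMeasure_univ] at h
  rw [← h, expMeasure, integral_withDensity_eq_integral_toReal_smul hx.measurable_exp
    (Eventually.of_forall fun s => ENNReal.ofReal_lt_top)]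
  refine setIntegral_congr_fun (measurableSet_alive_section z) fun s hs => ?_
  have hexp : ((Real.exp (x s.toNNReal) : ℝ) : ℂ) ^ (β - 1) =
      Complex.exp ((β - 1) * x s.toNNReal) := by
    rw [Complex.cpow_def_of_ne_zero (by exact_mod_cast (Real.exp_pos _).ne'),
      ← Complex.ofReal_log (Real.exp_pos _).le, Real.log_exp, mul_comm]
  have hreal := expMeasure_real_Ici (x := x) (z := z) hs.1
  rw [expMeasure] at hreal
  simp only [hreal]
  rw [Complex.ofReal_mul, Complex.mul_cpow_ofReal_nonneg (Real.exp_pos _).le ENNReal.toReal_nonneg,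
    hexp, ENNReal.toReal_ofReal (Real.exp_pos _).le, Complex.real_smul, Complex.ofReal_exp,
    ← mul_assoc, ← Complex.exp_add]
  congr 2
  ring

/-- Differentiating a real power of the tail integral. -/
theorem IsRightCont.expInt_rpow (hx : IsRightCont x) (hfin : expInt x z < ∞) (hpos : 0 < z)
    {b : ℝ} (hb : 0 < b) :
    ENNReal.ofReal b * ∫⁻ s in {s : ℝ | 0 ≤ s ∧ ENNReal.ofReal s < z},
      ENNReal.ofReal (Real.exp (b * x s.toNNReal)) *
        expInt (shift x s.toNNReal) (z - s.toNNReal) ^ (b - 1) = expInt x z ^ b := by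
  have := isFiniteMeasure_expMeasure hfin
  have h := lintegral_tail_rpow (ν := expMeasure x z) hb
  rw [measureReal_def, expMeasure_univ, ← ENNReal.ofReal_rpow_of_pos
    (ENNReal.toReal_pos (hx.expInt_pos hpos).ne' hfin.ne), ENNReal.ofReal_toReal hfin.ne] at h
  have hm : Measurable fun s => ENNReal.ofReal ((expMeasure x z).real (Ici s) ^ (b - 1)) :=
    ((antitone_measureReal_Ici (ν := expMeasure x z)).measurable.pow_const _).ennreal_ofReal
  have hwd := lintegral_withDensity_eq_lintegral_mul
    (volume.restrict {s : ℝ | 0 ≤ s ∧ ENNReal.ofReal s < z}) hx.measurable_exp hm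
  rw [← h]
  refine congrArg _ (Eq.trans ?_ hwd.symm)
  refine setLIntegral_congr_fun (measurableSet_alive_section z) fun s hs => ?_
  simp only [Pi.mul_apply]
  rw [expMeasure_real_Ici hs.1]
  set R := expInt (shift x s.toNNReal) (z - s.toNNReal) with hR
  -- For `b < 1` the power is negative, and real and extended powers then have different conventions
  -- at 0; so `R` must be positive and finite before passing between them.
  have hRpos : 0 < R := (hx.shifted _).expInt_pos (tsub_pos_of_lt hs.2)
  have hRtop : R ≠ ∞ := by
    have h1 : expMeasure x z (Ici s) < ∞ := measure_lt_top _ _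
    rw [expMeasure_Ici hs.1] at h1
    refine (ENNReal.lt_top_of_mul_ne_top_right h1.ne ?_).ne
    rw [Ne, ENNReal.ofReal_eq_zero, not_le]
    exact Real.exp_pos _
  have hRr : 0 < R.toReal := ENNReal.toReal_pos hRpos.ne' hRtop
  rw [Real.mul_rpow (Real.exp_pos _).le hRr.le, ENNReal.ofReal_mul (by positivity), ← mul_assoc,
    ← ENNReal.ofReal_mul (Real.exp_pos _).le, ← Real.exp_mul, ← Real.exp_add,
    ← ENNReal.ofReal_rpow_of_pos hRr, ENNReal.ofReal_toReal hRtop]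
  congr 3
  ring

end Pathwise

end ExpFunctional

/-! ### The moment identities -/

namespace ExpFunctional

variable {Ω : Type*} [MeasurableSpace Ω] {μ : Measure Ω} {X : ℝ≥0 → Ω → ℝ} {ζ : Ω → ℝ≥0∞} {q : ℝ}

lemma norm_ofReal_cpow_toReal {a : ℝ≥0∞} (h0 : 0 < a) (htop : a < ∞) (β : ℂ) :
    ‖((a.toReal : ℂ)) ^ β‖ₑ = a ^ β.re := by
  have hpos : 0 < a.toReal := ENNReal.toReal_pos h0.ne' htop.ne
  rw [← ofReal_norm, Complex.norm_cpow_eq_rpow_re_of_pos hpos,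
    ← ENNReal.ofReal_rpow_of_pos hpos, ENNReal.ofReal_toReal htop.ne]

/-- The set of times and scenarios in which the killed process is alive. -/
def aliveSet (ζ : Ω → ℝ≥0∞) : Set (ℝ × Ω) := {p | 0 ≤ p.1 ∧ ENNReal.ofReal p.1 < ζ p.2}

lemma measurableSet_aliveSet (hζ : Measurable ζ) : MeasurableSet (aliveSet ζ) :=
  measurableSet_alive_region.preimage (f := fun p : ℝ × Ω => (p.1, ζ p.2)) (by fun_prop)

/-- The exponential functional of the path after time `s`. -/
noncomputable def residual (X : ℝ≥0 → Ω → ℝ) (ζ : Ω → ℝ≥0∞) (p : ℝ × Ω) : ℝ≥0∞ :=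
  expInt (shift (fun t => X t p.2) p.1.toNNReal) (ζ p.2 - p.1.toNNReal)

lemma IsRegularLevy.measurable_residual (hX : IsRegularLevy X μ) (hζ : Measurable ζ) :
    Measurable (residual X ζ) := by
  have h : residual X ζ = fun p => expIntM (shift (fun t => X t p.2) p.1.toNNReal,
      ζ p.2 - p.1.toNNReal) := by
    ext p
    exact (((hX.rightCont p.2).shifted _).expIntM_eq _).symm
  rw [h]
  refine measurable_expIntM.comp (Measurable.prodMk (measurable_pi_lambda _ fun u => ?_) ?_)
  · have h1 : Measurable fun p : ℝ × Ω => X (p.1.toNNReal + u) p.2 :=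
      hX.measurable_uncurry.comp (f := fun p : ℝ × Ω => (p.1.toNNReal + u, p.2)) (by fun_prop)
    have h2 : Measurable fun p : ℝ × Ω => X p.1.toNNReal p.2 :=
      hX.measurable_uncurry.comp (f := fun p : ℝ × Ω => (p.1.toNNReal, p.2)) (by fun_prop)
    exact h1.sub h2
  · exact (hζ.comp measurable_snd).sub (by fun_prop)

lemma IsRegularLevy.measurable_eval_real (hX : IsRegularLevy X μ) :
    Measurable fun p : ℝ × Ω => X p.1.toNNReal p.2 :=
  hX.measurable_uncurry.comp (f := fun p : ℝ × Ω => (p.1.toNNReal, p.2)) (by fun_prop)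

omit [MeasurableSpace Ω] in
lemma indicator_aliveSet {α : Type*} [Zero α] (f : ℝ × Ω → α) {s : ℝ} (hs : 0 ≤ s) (ω : Ω) :
    (aliveSet ζ).indicator f (s, ω) =
      {ω | (s.toNNReal : ℝ≥0∞) < ζ ω}.indicator (fun ω => f (s, ω)) ω := by
  by_cases h : (s.toNNReal : ℝ≥0∞) < ζ ω
  · have h1 : (s, ω) ∈ aliveSet ζ := ⟨hs, h⟩
    have h2 : ω ∈ {ω | (s.toNNReal : ℝ≥0∞) < ζ ω} := h
    rw [indicator_of_mem h1, indicator_of_mem h2]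
  · have h1 : (s, ω) ∉ aliveSet ζ := fun h' => h h'.2
    have h2 : ω ∉ {ω | (s.toNNReal : ℝ≥0∞) < ζ ω} := h
    rw [indicator_of_notMem h1, indicator_of_notMem h2]

omit [MeasurableSpace Ω] in
lemma indicator_aliveSet_of_neg {α : Type*} [Zero α] (f : ℝ × Ω → α) {s : ℝ} (hs : s < 0) (ω : Ω) :
    (aliveSet ζ).indicator f (s, ω) = 0 :=
  indicator_of_notMem (fun h => not_le.2 hs h.1) _

lemma IsRegularLevy.measurable_aliveMoment (hX : IsRegularLevy X μ) (hζ : IsIndepExpTime X ζ q μ)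
    (b : ℝ) : Measurable fun s : ℝ => aliveMoment X ζ μ b s.toNNReal := by
  have := hX.isLevy.isProbabilityMeasure
  have hg : Measurable fun y : ℝ => ENNReal.ofReal (Real.exp (b * y)) := by fun_prop
  simp only [aliveMoment, hζ.lintegral_alive hX.isLevy _ hg]
  refine Measurable.mul (by fun_prop) ?_
  exact (hg.comp hX.measurable_eval_real).lintegral_prod_right'

lemma IsRegularLevy.aliveMoment_pos (hX : IsRegularLevy X μ) (hζ : IsIndepExpTime X ζ q μ)
    (b : ℝ) (t : ℝ≥0) : 0 < aliveMoment X ζ μ b t := by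
  have := hX.isLevy.measurable t
  rw [aliveMoment, lintegral_pos_iff_support (by fun_prop)]
  have hs : Function.support (fun ω => ENNReal.ofReal (Real.exp (b * X t ω))) = univ := by
    ext ω
    simp [Real.exp_pos]
  rw [hs, aliveMeasure, Measure.restrict_apply MeasurableSet.univ, univ_inter, hζ.tail]
  exact ENNReal.ofReal_pos.2 (Real.exp_pos _)

/-- The moment identity in `[0, ∞]`, in product form and after integrating out the past. -/
theorem IsRegularLevy.absMoment_eq (hX : IsRegularLevy X μ) (hζ : IsIndepExpTime X ζ q μ)
    {b : ℝ} (hb : 0 < b) (h : absMoment X ζ μ b < ∞) :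
    absMoment X ζ μ b = ENNReal.ofReal b * ∫⁻ p, (aliveSet ζ).indicator (fun p =>
      ENNReal.ofReal (Real.exp (b * X p.1.toNNReal p.2)) * residual X ζ p ^ (b - 1)) p
        ∂(volume.prod μ) ∧
    absMoment X ζ μ b = ENNReal.ofReal b * ((∫⁻ s in Ici (0 : ℝ),
      aliveMoment X ζ μ b s.toNNReal) * absMoment X ζ μ (b - 1)) := by
  have := hX.isLevy.isProbabilityMeasure
  have hA := measurableSet_aliveSet hζ.measurable
  have hres := hX.measurable_residual hζ.measurable
  have hXm := hX.measurable_eval_real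
  have hg : Measurable fun y : ℝ => ENNReal.ofReal (Real.exp (b * y)) := by fun_prop
  set u : ℝ × Ω → ℝ≥0∞ := fun p =>
    ENNReal.ofReal (Real.exp (b * X p.1.toNNReal p.2)) * residual X ζ p ^ (b - 1) with hudef
  have hu : Measurable u := (hg.comp hXm).mul (hres.pow_const _)
  have hui : Measurable ((aliveSet ζ).indicator u) := hu.indicator hA
  have h1 : absMoment X ζ μ b = ENNReal.ofReal b * ∫⁻ p, (aliveSet ζ).indicator u p
      ∂(volume.prod μ) := by
    -- Integrating over time first gives the pathwise identity; integrating over scenarios first,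
    -- further below, gives the Markov factorization.
    rw [lintegral_prod_symm _ hui.aemeasurable, ← lintegral_const_mul' _ _ ENNReal.ofReal_ne_top,
      absMoment]
    refine lintegral_congr_ae ?_
    filter_upwards [hX.ae_expFunctional_lt_top hζ hb h, hζ.ae_pos] with ω hω hω'
    have h2 := (hX.rightCont ω).expInt_rpow hω hω' hb
    rw [show expFunctional X ζ ω ^ b = _ from h2.symm,
      ← lintegral_indicator (measurableSet_alive_section _)]
    rfl
  refine ⟨h1, ?_⟩
  rw [h1, lintegral_prod _ hui.aemeasurable,
    ← lintegral_mul_const'' _ (hX.measurable_aliveMoment hζ b).aemeasurable,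
    ← lintegral_indicator measurableSet_Ici]
  congr 1
  refine lintegral_congr fun s => ?_
  rcases lt_or_ge s 0 with hs | hs
  · simp only [indicator_aliveSet_of_neg _ hs, lintegral_zero]
    rw [indicator_of_notMem (by exact not_le.2 hs)]
  · simp only [indicator_aliveSet _ hs]
    rw [indicator_of_mem (by exact hs), lintegral_indicator (measurableSet_alive hζ _)]
    exact hX.lintegral_restart_moment hζ b (b - 1) s.toNNReal

/-- If the moment of order `b` is finite, so is the moment of order `b - 1`. -/
theorem IsRegularLevy.absMoment_sub_one_lt_top (hX : IsRegularLevy X μ)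
    (hζ : IsIndepExpTime X ζ q μ) {b : ℝ} (hb : 0 < b) (h : absMoment X ζ μ b < ∞) :
    absMoment X ζ μ (b - 1) < ∞ := by
  have heq := (hX.absMoment_eq hζ hb h).2
  rw [heq] at h
  have hb' : ENNReal.ofReal b ≠ 0 := (ENNReal.ofReal_pos.2 hb).ne'
  have hpos : ∫⁻ s in Ici (0 : ℝ), aliveMoment X ζ μ b s.toNNReal ≠ 0 := by
    refine (pos_iff_ne_zero.1 ((setLIntegral_pos_iff (hX.measurable_aliveMoment hζ b)).2 ?_))
    have : Function.support (fun s : ℝ => aliveMoment X ζ μ b s.toNNReal) = univ := by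
      ext s
      simpa using (hX.aliveMoment_pos hζ b s.toNNReal).ne'
    rw [this, univ_inter]
    simp
  exact ENNReal.lt_top_of_mul_ne_top_right
    (ENNReal.lt_top_of_mul_ne_top_right h.ne hb').ne hpos

lemma IsRegularLevy.integrable_cpow (hX : IsRegularLevy X μ) (hζ : IsIndepExpTime X ζ q μ)
    (hfin : ∀ᵐ ω ∂μ, expFunctional X ζ ω < ∞) {β : ℂ} (h : absMoment X ζ μ β.re < ∞) :
    Integrable (expFunctionalCpow X ζ β) μ := by
  have hm := hX.measurable_expFunctional hζ.measurable
  have hm' : Measurable (expFunctionalCpow X ζ β) := by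
    unfold expFunctionalCpow
    fun_prop
  refine ⟨hm'.aestronglyMeasurable, ?_⟩
  rw [hasFiniteIntegral_iff_enorm]
  refine lt_of_le_of_lt (le_of_eq (lintegral_congr_ae ?_)) h
  filter_upwards [hfin, hX.ae_expFunctional_pos hζ] with ω h1 h2
  exact norm_ofReal_cpow_toReal h2 h1 β

/-- The moment identity for complex orders. -/
theorem IsRegularLevy.integral_cpow_eq (hX : IsRegularLevy X μ) (hζ : IsIndepExpTime X ζ q μ)
    {β ψ : ℂ} (hβ : 0 < β.re) (hψ : 0 < ψ.re)
    (hmgf : ∀ t : ℝ≥0, complexMGF (X t) (aliveMeasure ζ μ t) β = Complex.exp (-(t * ψ)))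
    (h : absMoment X ζ μ β.re < ∞) :
    ∫ ω, expFunctionalCpow X ζ β ω ∂μ =
      β / ψ * ∫ ω, expFunctionalCpow X ζ (β - 1) ω ∂μ := by
  have := hX.isLevy.isProbabilityMeasure
  have hβ0 : β ≠ 0 := fun h => by simp [h] at hβ
  have hfin := hX.ae_expFunctional_lt_top hζ hβ h
  have hA := measurableSet_aliveSet hζ.measurable
  have hres := hX.measurable_residual hζ.measurable
  have hg : Measurable fun y : ℝ => Complex.exp (β * y) := by fun_prop
  have hcpow : Measurable fun a : ℝ≥0∞ => ((a.toReal : ℂ)) ^ (β - 1) := by fun_prop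
  let w : ℝ × Ω → ℂ := fun p =>
    Complex.exp (β * X p.1.toNNReal p.2) * ((residual X ζ p).toReal : ℂ) ^ (β - 1)
  have hw : Measurable w := (hg.comp hX.measurable_eval_real).mul (hcpow.comp hres)
  have hwi : Measurable ((aliveSet ζ).indicator w) := hw.indicator hA
  have hae : ∀ᵐ p ∂((volume : Measure ℝ).prod μ), expFunctional X ζ p.2 < ∞ :=
    Measure.quasiMeasurePreserving_snd.ae hfin
  -- The norm of `w` on the alive set is almost everywhere the integrand of the real identity for
  -- the order `β.re`, whose integral is finite.
  have hint : Integrable ((aliveSet ζ).indicator w) (volume.prod μ) := by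
    refine ⟨hwi.aestronglyMeasurable, ?_⟩
    rw [hasFiniteIntegral_iff_enorm]
    have heq := (hX.absMoment_eq hζ hβ h).1
    rw [heq] at h
    refine lt_of_le_of_lt (le_of_eq (lintegral_congr_ae ?_))
      (ENNReal.lt_top_of_mul_ne_top_right h.ne (ENNReal.ofReal_pos.2 hβ).ne')
    filter_upwards [hae] with p hp
    by_cases hpA : p ∈ aliveSet ζ
    · rw [indicator_of_mem hpA, indicator_of_mem hpA]
      have hpos : 0 < residual X ζ p :=
        ((hX.rightCont p.2).shifted _).expInt_pos (tsub_pos_of_lt hpA.2)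
      have htop : residual X ζ p < ∞ := by
        have hsplit := expInt_eq_add (fun t => X t p.2) (z := ζ p.2) (s := p.1.toNNReal) hpA.2.le
        have hp' : expInt (fun t => X t p.2) (ζ p.2) < ∞ := hp
        rw [hsplit] at hp'
        refine ENNReal.lt_top_of_mul_ne_top_right (ENNReal.add_lt_top.1 hp').2.ne ?_
        exact (ENNReal.ofReal_pos.2 (Real.exp_pos _)).ne'
      rw [enorm_mul, norm_ofReal_cpow_toReal hpos htop, ← ofReal_norm, norm_exp_mul_ofReal]
      simp
    · rw [indicator_of_notMem hpA, indicator_of_notMem hpA, enorm_zero]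
  have h1 : ∫ p, (aliveSet ζ).indicator w p ∂(volume.prod μ) =
      (∫ ω, expFunctionalCpow X ζ β ω ∂μ) / β := by
    rw [integral_prod_symm _ hint, ← integral_div]
    refine integral_congr_ae ?_
    filter_upwards [hfin] with ω hω
    rw [expFunctionalCpow]
    refine Eq.trans ?_ ((hX.rightCont ω).expInt_cpow hω hβ)
    rw [← integral_indicator (measurableSet_alive_section _)]
    rfl
  have h2 : ∫ p, (aliveSet ζ).indicator w p ∂(volume.prod μ) =
      ψ⁻¹ * ∫ ω, expFunctionalCpow X ζ (β - 1) ω ∂μ := by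
    -- The Markov property at time `s` separates e^{-sψ} from the moment of order `β - 1`;
    -- integrating over `s ≥ 0` gives `ψ⁻¹` because `ψ` has positive real part.
    have hinner : ∀ s : ℝ, ∫ ω, (aliveSet ζ).indicator w (s, ω) ∂μ =
        (Ici (0 : ℝ)).indicator (fun s : ℝ => Complex.exp (-ψ * s) *
          ∫ ω, expFunctionalCpow X ζ (β - 1) ω ∂μ) s := by
      intro s
      rcases lt_or_ge s 0 with hs | hs
      · simp only [indicator_aliveSet_of_neg _ hs, integral_zero]
        rw [indicator_of_notMem (by exact not_le.2 hs)]
      · simp only [indicator_aliveSet _ hs]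
        rw [indicator_of_mem (by exact hs), integral_indicator (measurableSet_alive hζ _)]
        have hrest := hX.integral_restart hζ s.toNNReal hg (hcpow.comp measurable_expIntM)
        simp only [Function.comp, ((hX.rightCont _).shifted s.toNNReal).expIntM_eq,
          (hX.rightCont _).expIntM_eq] at hrest
        have hm := hmgf s.toNNReal
        rw [complexMGF] at hm
        rw [hm] at hrest
        refine hrest.trans ?_
        congr 2
        rw [show ((s.toNNReal : ℝ≥0) : ℂ) = ((s.toNNReal : ℝ) : ℂ) from rfl, Real.coe_toNNReal s hs]
        ring
    rw [integral_prod _ hint]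
    simp only [hinner]
    rw [integral_indicator measurableSet_Ici, integral_Ici_eq_integral_Ioi, integral_mul_const,
      integral_exp_mul_complex_Ioi (by simpa using hψ)]
    congr 1
    simp [neg_div_neg_eq]
  have h3 := h1.symm.trans h2
  rw [div_eq_iff hβ0] at h3
  rw [h3]
  ring

end ExpFunctional

/-! ### Passage to a regular version and conclusion -/

namespace ExpFunctional

variable {Ω : Type*} [MeasurableSpace Ω] {μ : Measure Ω} {X Y : ℝ≥0 → Ω → ℝ} {ζ : Ω → ℝ≥0∞} {q : ℝ}

/-- The three assertions about an admissible exponent. -/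
def MomentAssertion (X : ℝ≥0 → Ω → ℝ) (ζ : Ω → ℝ≥0∞) (μ : Measure Ω) (Ψ : ℂ → ℂ) (β : ℂ) : Prop :=
  Ψ (-(Complex.I * β)) ≠ 0 ∧
  (absMoment X ζ μ β.re < ∞ ↔ mgf (X 1) (aliveMeasure ζ μ 1) β.re < 1) ∧
  (absMoment X ζ μ β.re < ∞ →
    absMoment X ζ μ (β.re - 1) < ∞ ∧
    Integrable (expFunctionalCpow X ζ β) μ ∧
    Integrable (expFunctionalCpow X ζ (β - 1)) μ ∧
    ∫ ω, expFunctionalCpow X ζ β ω ∂μ =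
      β / Ψ (-(Complex.I * β)) * ∫ ω, expFunctionalCpow X ζ (β - 1) ω ∂μ)

theorem IsRegularLevy.momentAssertion (hX : IsRegularLevy X μ) (hζ : IsIndepExpTime X ζ q μ)
    {Ψ : ℂ → ℂ} (hΨ : IsCharExponent X ζ μ Ψ) {β : ℂ} (hβ : β ∈ admissible X ζ μ) :
    MomentAssertion X ζ μ Ψ β := by
  have := hX.isLevy.isProbabilityMeasure
  obtain ⟨hre, hmem, hnorm⟩ := hβ
  obtain ⟨Ψ₀, hΨ₀, hmgf⟩ := hX.exists_charExponent hζ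
  have h0 : (0 : ℝ) ∈ expMomentSet X ζ μ := by
    rw [hζ.expMomentSet_eq hX.isLevy]
    simp [integrableExpSet]
  have heq := hΨ.eq_of_re_pos hΨ₀ h0 hre hmem
  have hm := hmgf β hmem
  rw [← heq] at hm
  -- The modulus of e^{-Ψ(-iβ)} is e^{-Re Ψ(-iβ)}, so admissibility gives the positivity that makes
  -- the time integral converge.
  have hψ : 0 < (Ψ (-(Complex.I * β))).re := by
    rw [hm 1, Complex.norm_exp, Real.exp_lt_one_iff] at hnorm
    simpa using hnorm
  refine ⟨fun h => by simp [h] at hψ, ⟨fun h => ?_, fun h => ?_⟩, fun h => ?_⟩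
  · exact (mgf_lt_one_iff (hX.isLevy.measurable 1) hmem).2 (hX.aliveMoment_lt_one hζ hre h)
  · exact hX.absMoment_lt_top hζ hre hmem ((mgf_lt_one_iff (hX.isLevy.measurable 1) hmem).1 h)
  · have hfin := hX.ae_expFunctional_lt_top hζ hre h
    have hsub := hX.absMoment_sub_one_lt_top hζ hre h
    exact ⟨hsub, hX.integrable_cpow hζ hfin h,
      hX.integrable_cpow hζ hfin (by simpa using hsub), hX.integral_cpow_eq hζ hre hψ hm h⟩

/-- Every Lévy process is indistinguishable from a regular one. -/
lemma IsLevyProcess.exists_regular (hX : IsLevyProcess X μ) :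
    ∃ Y : ℝ≥0 → Ω → ℝ, IsRegularLevy Y μ ∧ ∀ᵐ ω ∂μ, ∀ t, X t ω = Y t ω := by
  have := hX.isProbabilityMeasure
  obtain ⟨N, hN, hNm, hN0⟩ := exists_measurable_superset_of_null
    (ae_iff.1 (hX.start_zero.and hX.cadlag))
  have hgood : ∀ ω ∉ N, X 0 ω = 0 ∧ IsCadlag (fun t => X t ω) := fun ω hω => by
    by_contra h
    exact hω (hN h)
  -- The exceptional set is first enlarged to a measurable null set, so that replacing the path by 0
  -- there preserves measurability at every time.
  let Y : ℝ≥0 → Ω → ℝ := fun t => Nᶜ.indicator (X t)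
  have hae : ∀ᵐ ω ∂μ, ∀ t, X t ω = Y t ω := by
    filter_upwards [measure_eq_zero_iff_ae_notMem.1 hN0] with ω hω t
    exact (indicator_of_mem (show ω ∈ Nᶜ from hω) _).symm
  have hYm : ∀ t, Measurable (Y t) := fun t => (hX.measurable t).indicator hNm.compl
  have hcad : ∀ ω, Y 0 ω = 0 ∧ IsCadlag (fun t => Y t ω) := by
    intro ω
    by_cases hω : ω ∈ N
    · have h : (fun t => Y t ω) = fun _ => 0 :=
        funext fun t => indicator_of_notMem (by simpa using hω) _
      refine ⟨congrFun h 0, ?_⟩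
      rw [h]
      exact fun t => ⟨continuousWithinAt_const, 0, tendsto_const_nhds⟩
    · have h : (fun t => Y t ω) = fun t => X t ω :=
        funext fun t => indicator_of_mem (by simpa using hω) _
      refine ⟨(congrFun h 0).trans (hgood ω hω).1, ?_⟩
      rw [h]
      exact (hgood ω hω).2
  refine ⟨Y, ⟨⟨hYm, Eventually.of_forall fun ω => (hcad ω).1, ?_, fun s t => ?_,
    Eventually.of_forall fun ω => (hcad ω).2⟩, fun ω => (hcad ω).1,
    fun ω t => ((hcad ω).2 t).1⟩, hae⟩
  · intro n t ht
    refine (hX.indep_increments n t ht).congr fun i => ?_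
    filter_upwards [hae] with ω hω
    rw [hω, hω]
  · refine ⟨((hYm _).sub (hYm _)).aemeasurable, (hYm t).aemeasurable, ?_⟩
    have h1 : μ.map (fun ω => Y (s + t) ω - Y s ω) = μ.map (fun ω => X (s + t) ω - X s ω) :=
      Measure.map_congr (by filter_upwards [hae] with ω hω; rw [hω, hω])
    have h2 : μ.map (Y t) = μ.map (X t) :=
      Measure.map_congr (by filter_upwards [hae] with ω hω; rw [hω])
    rw [h1, h2]
    exact (hX.stationary_increments s t).map_eq

/-! ### Invariance under indistinguishability -/

section Congr

variable (h : ∀ᵐ ω ∂μ, ∀ t, X t ω = Y t ω)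

include h

lemma ae_alive_eq (t : ℝ≥0) : X t =ᵐ[aliveMeasure ζ μ t] Y t :=
  ae_restrict_of_ae (h.mono fun _ hω => hω t)

lemma IsIndepExpTime.congr (hζ : IsIndepExpTime X ζ q μ) : IsIndepExpTime Y ζ q μ :=
  ⟨hζ.rate_nonneg, hζ.measurable, hζ.tail,
    hζ.indep.congr (h.mono fun _ hω => funext hω) .rfl⟩

lemma expMomentSet_congr : expMomentSet X ζ μ = expMomentSet Y ζ μ := by
  ext a
  refine integrable_congr ?_
  filter_upwards [ae_alive_eq h 1] with ω hω
  rw [hω]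

lemma isCharExponent_congr {Ψ : ℂ → ℂ} (hΨ : IsCharExponent X ζ μ Ψ) :
    IsCharExponent Y ζ μ Ψ := by
  refine ⟨fun l t => ?_, expMomentSet_congr (ζ := ζ) h ▸ hΨ.continuousOn,
    expMomentSet_congr (ζ := ζ) h ▸ hΨ.differentiableOn⟩
  rw [← hΨ.charFun_eq]
  refine integral_congr_ae ?_
  filter_upwards [ae_alive_eq h t] with ω hω
  rw [hω]

lemma admissible_congr : admissible X ζ μ = admissible Y ζ μ := by
  have e : complexMGF (X 1) (aliveMeasure ζ μ 1) = complexMGF (Y 1) (aliveMeasure ζ μ 1) := by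
    ext w
    refine integral_congr_ae ?_
    filter_upwards [ae_alive_eq h 1] with ω hω
    rw [hω]
  rw [admissible, admissible, e, expMomentSet_congr h]

lemma expFunctional_ae_eq : expFunctional X ζ =ᵐ[μ] expFunctional Y ζ := by
  filter_upwards [h] with ω hω
  simp only [expFunctional, hω]

lemma momentAssertion_congr {Ψ : ℂ → ℂ} {β : ℂ} (hM : MomentAssertion Y ζ μ Ψ β) :
    MomentAssertion X ζ μ Ψ β := by
  have hI := expFunctional_ae_eq (ζ := ζ) h
  have h1 : ∀ a, absMoment X ζ μ a = absMoment Y ζ μ a := fun a =>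
    lintegral_congr_ae (hI.mono fun ω hω => congrArg (· ^ a) hω)
  have h2 : ∀ b, expFunctionalCpow X ζ b =ᵐ[μ] expFunctionalCpow Y ζ b := fun b =>
    hI.mono fun ω hω => by rw [expFunctionalCpow, expFunctionalCpow, hω]
  have h3 : mgf (X 1) (aliveMeasure ζ μ 1) = mgf (Y 1) (aliveMeasure ζ μ 1) :=
    funext fun _ => mgf_congr (ae_alive_eq h 1)
  unfold MomentAssertion at hM ⊢
  rw [h1, h1, h3, integrable_congr (h2 β), integrable_congr (h2 (β - 1)),
    integral_congr_ae (h2 β), integral_congr_ae (h2 (β - 1))]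
  exact hM

end Congr

end ExpFunctional

theorem corollary1 {Ω : Type*} [MeasurableSpace Ω] (μ : Measure Ω) [IsProbabilityMeasure μ]
    (X : ℝ≥0 → Ω → ℝ) (ζ : Ω → ℝ≥0∞) (q : ℝ)
    (hX : ExpFunctional.IsLevyProcess X μ)
    (hζ : ExpFunctional.IsIndepExpTime X ζ q μ)
    (hq : 0 < q ∨ (q = 0 ∧ ∀ᵐ ω ∂μ, Tendsto (fun t => X t ω) atTop atBot)) :
    (∃ Ψ : ℂ → ℂ, ExpFunctional.IsCharExponent X ζ μ Ψ) ∧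
    ∀ Ψ : ℂ → ℂ, ExpFunctional.IsCharExponent X ζ μ Ψ →
      ∀ β ∈ ExpFunctional.admissible X ζ μ,
        Ψ (-(Complex.I * β)) ≠ 0 ∧
        (ExpFunctional.absMoment X ζ μ β.re < ∞ ↔
          mgf (X 1) (ExpFunctional.aliveMeasure ζ μ 1) β.re < 1) ∧
        (ExpFunctional.absMoment X ζ μ β.re < ∞ →
          ExpFunctional.absMoment X ζ μ (β.re - 1) < ∞ ∧
          Integrable (ExpFunctional.expFunctionalCpow X ζ β) μ ∧
          Integrable (ExpFunctional.expFunctionalCpow X ζ (β - 1)) μ ∧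
          ∫ ω, ExpFunctional.expFunctionalCpow X ζ β ω ∂μ =
            β / Ψ (-(Complex.I * β)) *
              ∫ ω, ExpFunctional.expFunctionalCpow X ζ (β - 1) ω ∂μ) := by
  obtain ⟨Y, hY, hXY⟩ := hX.exists_regular
  have hζY := hζ.congr hXY
  have hYX : ∀ᵐ ω ∂μ, ∀ t, Y t ω = X t ω := hXY.mono fun _ h t => (h t).symm
  refine ⟨?_, fun Ψ hΨ β hβ => ?_⟩
  · obtain ⟨Ψ, hΨ, -⟩ := hY.exists_charExponent hζY
    exact ⟨Ψ, ExpFunctional.isCharExponent_congr hYX hΨ⟩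
  · exact ExpFunctional.momentAssertion_congr hXY (hY.momentAssertion hζY
      (ExpFunctional.isCharExponent_congr hXY hΨ) (ExpFunctional.admissible_congr hXY ▸ hβ))
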